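/- Let $\mathbb H^2$ be the oriented hyperbolic plane (the upper half-plane with the metric $y^{-2}(dx^2+dy^2)$ and its standard orientation), and let $\mathrm{Isom}^+(\mathbb H^2)$ be its group of orientation preserving isometries, with the topology of pointwise convergence. Fix a point $p\in\mathbb H^2$ and a unit tangent vector $v$ at $p$. Let $R$ be the clockwise rotation by a right angle fixing $p$, for $r>0$ let $A_r$ be the translation of distance $r$ along the positive direction of the geodesic with initial condition $v$, and let $G_r\subset \mathrm{Isom}^+(\mathbb H^2)$ be the group generated by $R$ and $A_r$. For each integer $n\ge 5$ put $$r_n=\operatorname{acosh}\bigl(1+2\cos(2\pi/n)\bigr),$$ and let $T_n$ be the (solid, compact) geodesic triangle with vertices $p,q,s$ such that the side $[p,q]$ leaves $p$ in direction $v$, the side $[p,s]$ leaves $p$ in the direction obtained from $v$ by a clockwise turn of angle $\pi/4$, and the interior angles at $p,q,s$ are $\pi/4,\pi/4,2\pi/n$ respectively. **Proposition.** For each $n\ge 5$ the group $G_{r_n}$ is discrete, a triangle $T_n$ as above exists, and every such triangle $T_n$ is a fundamental domain for $G_{r_n}$: the translates $g(T_n)$, $g\in G_{r_n}$, cover $\mathbb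 H^2$, and for distinct $g,h\in G_{r_n}$ the translate $g(T_n)$ contains no interior point of $h(T_n)$. -/

import Mathlib

namespace HypTurtle

open UpperHalfPlane

/-!
The hyperbolic plane is the upper half-plane `ℍ` with Mathlib's hyperbolic distance and the
orientation of `ℂ`. The metric is `|dz|² / (im z)²`, hence conformal: a tangent vector at `p` is a
complex number `v`, of hyperbolic length `‖v‖ / im p`, and hyperbolic angles between tangent vectors
at `p` are Euclidean angles.
-/

/-- Unit tangent vectors of the hyperbolic plane at `p`. -/
def UnitTangent (p : ℍ) : Type := {v : ℂ // ‖v‖ = p.im}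

/-- The tangent vector `v` turned clockwise through the angle `θ`. -/
noncomputable def UnitTangent.turnCW {p : ℍ} (v : UnitTangent p) (θ : ℝ) : UnitTangent p :=
  ⟨Complex.exp (-(θ * Complex.I)) * v.1, by
    have h : -((θ : ℂ) * Complex.I) = ((-θ : ℝ) : ℂ) * Complex.I := by push_cast; ring
    rw [norm_mul, h, Complex.norm_exp_ofReal_mul_I, one_mul, v.2]⟩

/-! ### Orientation preserving isometries -/

/-- The action of `SL(2, ℝ)` on `ℍ` by the isometries `z ↦ (az + b) / (cz + d)`. -/
noncomputable def moebius : Matrix.SpecialLinearGroup (Fin 2) ℝ →* (ℍ ≃ᵢ ℍ) where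
  toFun g := IsometryEquiv.constSMul g
  map_one' := by ext z; simp
  map_mul' g h := by ext z; simp [mul_smul]

/-- The group of orientation preserving isometries of the hyperbolic plane: the Möbius
transformations with real coefficients and determinant one. -/
noncomputable def IsomPlus : Subgroup (ℍ ≃ᵢ ℍ) := moebius.range

/-- The topology of pointwise convergence. -/
noncomputable instance : TopologicalSpace IsomPlus :=
  TopologicalSpace.induced (fun (g : IsomPlus) (z : ℍ) => g.1 z) inferInstance

/-- The matrix `g`, chosen up to sign, with `g • i = p` and with derivative at `i` taking the
upward unit vector `i` to `v`; its bottom row is given by `(c i + d)² = i / v`. -/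
noncomputable def frame (p : ℍ) (v : UnitTangent p) : Matrix.SpecialLinearGroup (Fin 2) ℝ :=
  ⟨!![((p : ℂ) * (Complex.I / v.1) ^ (1 / 2 : ℂ)).im, ((p : ℂ) * (Complex.I / v.1) ^ (1 / 2 : ℂ)).re;
      ((Complex.I / v.1) ^ (1 / 2 : ℂ)).im, ((Complex.I / v.1) ^ (1 / 2 : ℂ)).re], by
    have hp : 0 < p.im := p.im_pos
    have h2 : ((Complex.I / v.1) ^ (1 / 2 : ℂ)) ^ 2 = Complex.I / v.1 := by
      rw [one_div]; exact Complex.cpow_nat_inv_pow _ two_ne_zero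
    set u := (Complex.I / v.1) ^ (1 / 2 : ℂ)
    have h3 : ‖u‖ ^ 2 = 1 / p.im := by
      rw [← norm_pow, h2, norm_div, Complex.norm_I, v.2]
    rw [← Complex.normSq_eq_norm_sq, Complex.normSq_apply] at h3
    have h4 : p.im * (u.re * u.re + u.im * u.im) = 1 := by rw [h3]; field_simp
    rw [Matrix.det_fin_two_of]
    simp only [Complex.mul_im, Complex.mul_re, coe_re, coe_im]
    linarith⟩

/-- The diagonal matrix that translates the imaginary axis upwards by the distance `t`. -/
noncomputable def diagMat (t : ℝ) : Matrix.SpecialLinearGroup (Fin 2) ℝ :=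
  ⟨!![Real.exp (t / 2), 0; 0, Real.exp (-(t / 2))], by
    rw [Matrix.det_fin_two_of, ← Real.exp_add]; simp⟩

/-- The matrix that acts on `ℍ` as the clockwise rotation about `i` of angle `2 θ`. -/
noncomputable def rotMat (θ : ℝ) : Matrix.SpecialLinearGroup (Fin 2) ℝ :=
  ⟨!![Real.cos θ, -Real.sin θ; Real.sin θ, Real.cos θ], by
    rw [Matrix.det_fin_two_of]; nlinarith [Real.sin_sq_add_cos_sq θ]⟩

/-- The unit speed geodesic with initial point `p` and initial velocity `v`. -/
noncomputable def geodesic (p : ℍ) (v : UnitTangent p) (t : ℝ) : ℍ :=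
  frame p v • (diagMat t • UpperHalfPlane.I)

/-- `A_r`: the translation of distance `r` along the positive direction of the geodesic with initial
condition `v`. -/
noncomputable def translation (p : ℍ) (v : UnitTangent p) (r : ℝ) : IsomPlus :=
  ⟨moebius (frame p v * diagMat r * (frame p v)⁻¹), ⟨_, rfl⟩⟩

/-- `R`: the clockwise rotation by a right angle fixing `p`. (It does not depend on `v`.) -/
noncomputable def quarterTurn (p : ℍ) (v : UnitTangent p) : IsomPlus :=
  ⟨moebius (frame p v * rotMat (Real.pi / 4) * (frame p v)⁻¹), ⟨_, rfl⟩⟩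

/-- `G_r`: the group generated by `R` and `A_r`. -/
noncomputable def turtleGroup (p : ℍ) (v : UnitTangent p) (r : ℝ) : Subgroup IsomPlus :=
  Subgroup.closure {quarterTurn p v, translation p v r}

/-- `r_n = acosh (1 + 2 cos (2π / n))`. -/
noncomputable def sideLength (n : ℕ) : ℝ := Real.arcosh (1 + 2 * Real.cos (2 * Real.pi / n))

/-! ### Geodesic triangles -/

/-- The geodesic segment between `a` and `b`. -/
def segment (a b : ℍ) : Set ℍ := {z | dist a z + dist z b = dist a b}

/-- The (solid, closed) geodesic triangle with vertices `a`, `b`, `c`: the union of the geodesic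
segments from `a` to the points of the opposite side. -/
def triangle (a b c : ℍ) : Set ℍ := {z | ∃ x ∈ segment b c, z ∈ segment a x}

/-- The geodesic with initial condition `u` at `a` passes through `b` at a positive time: `u` is the
direction at `a` of the side from `a` to `b`. -/
def Points (a : ℍ) (u : UnitTangent a) (b : ℍ) : Prop := ∃ t : ℝ, 0 < t ∧ geodesic a u t = b

/-- The interior angle at the vertex `a` between the sides from `a` to `b` and from `a` to `c`
is `α`. -/
def HasAngle (a b c : ℍ) (α : ℝ) : Prop :=
  ∃ u w : UnitTangent a, Points a u b ∧ Points a w c ∧ InnerProductGeometry.angle u.1 w.1 = α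

/-- `p`, `q`, `s` are the vertices of `T_n`: the triangle with a vertex at `p`, whose edges `[p, q]`
and `[p, s]` have the directions `v` and `w`, where `w` is `v` turned clockwise by `π / 4`, with
interior angles `π / 4`, `π / 4`, `2π / n` at `p`, `q`, `s`. -/
structure IsPolygonTriangle (n : ℕ) (p : ℍ) (v : UnitTangent p) (q s : ℍ) : Prop where
  dir_q : Points p v q
  dir_s : Points p (v.turnCW (Real.pi / 4)) s
  angle_p : HasAngle p q s (Real.pi / 4)
  angle_q : HasAngle q p s (Real.pi / 4)
  angle_s : HasAngle s p q (2 * Real.pi / n)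

/-! ### Fundamental domains -/

/-- The translate `g P`. -/
def translate (g : IsomPlus) (P : Set ℍ) : Set ℍ := (fun z => g.1 z) '' P

/-- `P` is a fundamental domain for `G`: the translates of `P` cover the plane, and translates
by distinct elements do not meet at an interior point. -/
structure IsFundDomain (G : Subgroup IsomPlus) (P : Set ℍ) : Prop where
  cover : ⋃ g ∈ G, translate g P = Set.univ
  disjoint_interior : ∀ g ∈ G, ∀ h ∈ G, g ≠ h →
    Disjoint (translate g P) (interior (translate h P))

/-! ### The explicit formulas above have the defining properties -/

theorem frame_denom_sq (p : ℍ) (v : UnitTangent p) :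
    (((frame p v) 1 0 : ℂ) * Complex.I + (frame p v) 1 1) ^ 2 = Complex.I / v.1 := by
  have h2 : ((Complex.I / v.1) ^ (1 / 2 : ℂ)) ^ 2 = Complex.I / v.1 := by
    rw [one_div]; exact Complex.cpow_nat_inv_pow _ two_ne_zero
  conv_rhs => rw [← h2]
  congr 1
  simp only [frame, Matrix.SpecialLinearGroup.coe_mk, Matrix.of_apply, Matrix.cons_val]
  rw [add_comm]; exact Complex.re_add_im _

theorem frame_smul_I (p : ℍ) (v : UnitTangent p) : frame p v • UpperHalfPlane.I = p := by
  have hv : v.1 ≠ 0 := by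
    intro h
    have := v.2
    rw [h, norm_zero] at this
    exact p.im_pos.ne this
  have h0 : ((frame p v) 1 0 : ℂ) * Complex.I + (frame p v) 1 1 ≠ 0 := by
    intro h
    have := frame_denom_sq p v
    rw [h] at this
    exact div_ne_zero Complex.I_ne_zero hv (by rw [← this]; simp)
  apply UpperHalfPlane.ext
  rw [coe_specialLinearGroup_apply]
  simp only [Algebra.algebraMap_self, RingHom.id_apply, coe_I]
  rw [div_eq_iff h0]
  simp only [frame, Matrix.SpecialLinearGroup.coe_mk, Matrix.of_apply, Matrix.cons_val]
  rw [add_comm, Complex.re_add_im, add_comm, Complex.re_add_im]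

theorem diagMat_smul_I (t : ℝ) :
    ((diagMat t • UpperHalfPlane.I : ℍ) : ℂ) = Complex.exp t * Complex.I := by
  rw [coe_specialLinearGroup_apply]
  simp only [diagMat, Matrix.SpecialLinearGroup.coe_mk, Matrix.of_apply, Matrix.cons_val,
    Algebra.algebraMap_self, RingHom.id_apply, coe_I, Complex.ofReal_zero, zero_mul, zero_add,
    add_zero, Complex.ofReal_exp]
  rw [mul_div_right_comm, ← Complex.exp_sub]
  congr 2
  push_cast
  ring

theorem hasDerivAt_smul (g : Matrix.SpecialLinearGroup (Fin 2) ℝ) (z : ℝ → ℍ) (w : ℂ)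
    (hz : z 0 = UpperHalfPlane.I) (h : HasDerivAt (fun t => (z t : ℂ)) w 0) :
    HasDerivAt (fun t => ((g • z t : ℍ) : ℂ)) (w / ((g 1 0 : ℂ) * Complex.I + g 1 1) ^ 2) 0 := by
  have h0 : (g 1 0 : ℂ) * z 0 + g 1 1 ≠ 0 := by
    simpa [denom] using denom_ne_zero (g : Matrix.GeneralLinearGroup (Fin 2) ℝ) (z 0)
  have hd : (g 0 0 : ℂ) * g 1 1 - g 0 1 * g 1 0 = 1 := by
    have := g.2
    rw [Matrix.det_fin_two] at this
    exact_mod_cast this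
  simp only [coe_specialLinearGroup_apply, Algebra.algebraMap_self, RingHom.id_apply]
  have := ((h.const_mul (g 0 0 : ℂ)).add_const (g 0 1 : ℂ)).div
    ((h.const_mul (g 1 0 : ℂ)).add_const (g 1 1 : ℂ)) h0
  rw [hz, coe_I] at this
  refine this.congr_deriv ?_
  congr 1
  linear_combination w * hd

theorem diagMat_hasDerivAt :
    HasDerivAt (fun t : ℝ => ((diagMat t • UpperHalfPlane.I : ℍ) : ℂ)) Complex.I 0 := by
  simp only [diagMat_smul_I]
  have h : HasDerivAt (fun t : ℝ => Complex.exp (t : ℂ)) 1 0 := by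
    simpa using (Complex.ofRealCLM.hasDerivAt (x := (0 : ℝ))).cexp
  simpa using h.mul_const Complex.I

theorem diagMat_zero_smul : diagMat 0 • UpperHalfPlane.I = UpperHalfPlane.I := by
  apply UpperHalfPlane.ext
  rw [diagMat_smul_I]
  simp

theorem diagMat_mul (r t : ℝ) : diagMat r * diagMat t = diagMat (t + r) := by
  apply Subtype.ext
  change !![Real.exp (r / 2), 0; 0, Real.exp (-(r / 2))] *
    !![Real.exp (t / 2), 0; 0, Real.exp (-(t / 2))] =
    !![Real.exp ((t + r) / 2), 0; 0, Real.exp (-((t + r) / 2))]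
  have h1 : (t + r) / 2 = r / 2 + t / 2 := by ring
  rw [Matrix.mul_fin_two, h1, neg_add, Real.exp_add, Real.exp_add]
  simp

/-- `geodesic p v` is a unit speed, globally minimizing curve starting at `p`. -/
theorem geodesic_isometry (p : ℍ) (v : UnitTangent p) :
    Isometry (geodesic p v) ∧ geodesic p v 0 = p := by
  refine ⟨?_, by rw [geodesic, diagMat_zero_smul, frame_smul_I]⟩
  refine (isometry_smul ℍ (frame p v)).comp (f := fun t => diagMat t • UpperHalfPlane.I) ?_
  convert isometry_vertical_line 0 using 2 with t
  apply UpperHalfPlane.ext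
  rw [diagMat_smul_I, ← Complex.ofReal_exp]
  apply Complex.ext <;> simp [-Complex.ofReal_exp]

/-- The initial velocity of `geodesic p v` is `v`. -/
theorem geodesic_hasDerivAt (p : ℍ) (v : UnitTangent p) :
    HasDerivAt (fun t => (geodesic p v t : ℂ)) v.1 0 := by
  have := hasDerivAt_smul (frame p v) _ _ diagMat_zero_smul diagMat_hasDerivAt
  rwa [frame_denom_sq, div_div_cancel₀ Complex.I_ne_zero] at this

/-- `A_r` advances the geodesic by `r`. -/
theorem translation_geodesic (p : ℍ) (v : UnitTangent p) (r t : ℝ) :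
    (translation p v r).1 (geodesic p v t) = geodesic p v (t + r) := by
  change (frame p v * diagMat r * (frame p v)⁻¹) • (frame p v • (diagMat t • UpperHalfPlane.I)) = _
  rw [mul_smul, inv_smul_smul, mul_smul, ← mul_smul (diagMat r), diagMat_mul, geodesic]

/-- `R` fixes `p` and turns `v` clockwise by a right angle. -/
theorem quarterTurn_geodesic (p : ℍ) (v : UnitTangent p) :
    (quarterTurn p v).1 p = p ∧
    HasDerivAt (fun t => ((quarterTurn p v).1 (geodesic p v t) : ℂ)) (-Complex.I * v.1) 0 := by
  have hs : ((Real.sqrt 2 : ℝ) : ℂ) ^ 2 = 2 := by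
    rw [← Complex.ofReal_pow, Real.sq_sqrt (by norm_num)]; norm_num
  have hr : (((rotMat (Real.pi / 4)) 1 0 : ℂ) * Complex.I + (rotMat (Real.pi / 4)) 1 1) ^ 2
      = Complex.I := by
    simp only [rotMat, Matrix.SpecialLinearGroup.coe_mk, Matrix.of_apply, Matrix.cons_val,
      Real.cos_pi_div_four, Real.sin_pi_div_four]
    push_cast
    linear_combination (1 / 4 * (1 + Complex.I ^ 2 + 2 * Complex.I)) * hs + 1 / 2 * Complex.I_sq
  have hI : rotMat (Real.pi / 4) • UpperHalfPlane.I = UpperHalfPlane.I := by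
    apply UpperHalfPlane.ext
    have h0 : ((rotMat (Real.pi / 4)) 1 0 : ℂ) * Complex.I + (rotMat (Real.pi / 4)) 1 1 ≠ 0 := by
      intro h
      rw [h] at hr
      exact Complex.I_ne_zero (by rw [← hr]; simp)
    rw [coe_specialLinearGroup_apply]
    simp only [Algebra.algebraMap_self, RingHom.id_apply, coe_I]
    rw [div_eq_iff h0]
    simp only [rotMat, Matrix.SpecialLinearGroup.coe_mk, Matrix.of_apply, Matrix.cons_val]
    push_cast
    linear_combination (-Complex.sin (Real.pi / 4)) * Complex.I_sq
  have hR : ∀ z, (quarterTurn p v).1 z =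
      frame p v • (rotMat (Real.pi / 4) • ((frame p v)⁻¹ • z)) := fun z => by
    change (frame p v * rotMat (Real.pi / 4) * (frame p v)⁻¹) • z = _
    rw [mul_smul, mul_smul]
  constructor
  · rw [hR]
    nth_rewrite 3 [← frame_smul_I p v]
    rw [inv_smul_smul, hI, frame_smul_I]
  · have h1 := hasDerivAt_smul (rotMat (Real.pi / 4)) _ _ diagMat_zero_smul diagMat_hasDerivAt
    rw [hr, div_self Complex.I_ne_zero] at h1
    have h2 := hasDerivAt_smul (frame p v) _ _ (by rw [diagMat_zero_smul, hI]) h1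
    rw [frame_denom_sq] at h2
    simp only [hR, geodesic, inv_smul_smul]
    convert h2 using 1
    rw [one_div_div, Complex.div_I]
    ring

end HypTurtle

/-! The axis of symmetry of `T_n` cuts it into two right triangles with angles `π/4`, `π/2`, `π/n`.
A leg of such a right triangle is half of `[p, q]`, and `cosh r_n = 1 + 2 cos (2π/n)` is equivalent
to `cosh (r_n/2) = √2 cos (π/n)`, the relation between that leg and the angles. Let `W` be generated
by the reflections `c₀, c₁, c₂` in the line `pq`, the line `ps` and the axis. Then `R = c₁ c₀`, and
`A_r R² = c₀ c₂` is the half-turn about the midpoint of `[p, q]`; hence `G_r` is the orientation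
preserving subgroup of index two in `W`, and `T_n` is the chamber of `W` together with its mirror
image under `c₂`.

It remains to see that the chamber is a fundamental domain for `W`. In the hyperboloid model the
three walls are the zero sets of independent linear forms, on which the reflections act by the
geometric representation of the Coxeter group `(2, 4, n)`. Tits' argument, an induction on word
length through dihedral subgroups (`side_and_splitting`), shows that distinct translates of the open
chamber are disjoint. So a small ball about a chamber point `x` separates the elements of `W`, which
gives discreteness. For the covering, choose in the `W`-orbit of a point one nearest to `x`: if it
lay on the negative side of a wall, reflecting it would bring it nearer
(`exists_mem_closed_chamber`).

The angles of `T_n` determine `dist p q = r_n` and `dist p s = dist q s` by the law of cosines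
(`sides_of_angles`). Together with the two prescribed directions this identifies every `T_n` with
the double of the chamber (`isPolygonTriangle_eq`). -/

namespace HypTurtle

open UpperHalfPlane

/-! ### Reflection systems -/

/-- Isometries `s i` of a metric space that act on separating coordinates `F j` by the formulas of
the geometric representation of the Coxeter group with matrix `m`. -/
structure ReflectionSystem {ι E : Type*} [MetricSpace E] (s : ι → E ≃ᵢ E) (F : ι → E → ℝ)
    (m : ι → ι → ℕ) : Prop where
  m_symm : ∀ i j, m i j = m j i
  two_le_m : ∀ i j, i ≠ j → 2 ≤ m i j
  apply_self : ∀ i z, F i (s i z) = -F i z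
  apply_of_ne : ∀ i j, i ≠ j → ∀ z, F j (s i z) = F j z + 2 * Real.cos (Real.pi / m i j) * F i z
  separating : ∀ z w, (∀ i, F i z = F i w) → z = w

/-- The product of the word `i j i j ⋯` of length `k`. -/
def alternating {ι Γ : Type*} [Group Γ] (s : ι → Γ) : ι → ι → ℕ → Γ
  | _, _, 0 => 1
  | i, j, k + 1 => s i * alternating s j i k

/-- `w` is the product of a word of length `n` in the generators `s`. -/
def IsWord {ι Γ : Type*} [Group Γ] (s : ι → Γ) (n : ℕ) (w : Γ) : Prop :=
  ∃ l : List ι, l.length = n ∧ (l.map s).prod = w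

/-- `n` is the least length of a word in the generators `s` whose product is `w`. -/
def IsWordLength {ι Γ : Type*} [Group Γ] (s : ι → Γ) (n : ℕ) (w : Γ) : Prop :=
  IsWord s n w ∧ ∀ k, IsWord s k w → n ≤ k

/-! ### Words and word length -/

section Words

variable {ι Γ : Type*} [Group Γ] {s : ι → Γ}

theorem isWord_zero {w : Γ} : IsWord s 0 w ↔ w = 1 := by
  constructor
  · rintro ⟨l, hl, rfl⟩
    simp [List.length_eq_zero_iff.1 hl]
  · rintro rfl
    exact ⟨[], rfl, rfl⟩

theorem IsWord.mul {n k : ℕ} {v w : Γ} (hv : IsWord s n v) (hw : IsWord s k w) :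
    IsWord s (n + k) (v * w) := by
  obtain ⟨l, rfl, rfl⟩ := hv
  obtain ⟨l', rfl, rfl⟩ := hw
  exact ⟨l ++ l', by simp, by simp⟩

theorem isWord_generator (i : ι) : IsWord s 1 (s i) := ⟨[i], rfl, by simp⟩

theorem isWord_alternating (k : ℕ) : ∀ i j : ι, IsWord s k (alternating s i j k) := by
  induction k with
  | zero => intro i j; exact isWord_zero.2 rfl
  | succ k ih =>
    intro i j
    have := (isWord_generator i).mul (ih j i)
    rwa [add_comm] at this

theorem IsWord.exists_eq_mul {n : ℕ} {w : Γ} (h : IsWord s (n + 1) w) :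
    ∃ i v, IsWord s n v ∧ w = s i * v := by
  obtain ⟨l, hl, rfl⟩ := h
  match l, hl with
  | i :: l, hl => exact ⟨i, (l.map s).prod, ⟨l, by simpa using hl, rfl⟩, by simp⟩

theorem IsWordLength.of_mul {n : ℕ} {i : ι} {v w : Γ} (h : IsWordLength s (n + 1) w)
    (hv : IsWord s n v) (hw : w = s i * v) : IsWordLength s n v := by
  refine ⟨hv, fun k hk => ?_⟩
  have := h.2 _ (hw ▸ (isWord_generator i).mul hk)
  omega

theorem exists_isWordLength {n : ℕ} {w : Γ} (h : IsWord s n w) : ∃ k, IsWordLength s k w := by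
  classical
  have h' : ∃ n, IsWord s n w := ⟨n, h⟩
  exact ⟨Nat.find h', Nat.find_spec h', fun k hk => Nat.find_min' h' hk⟩

theorem exists_isWord_of_mem_closure (hs : ∀ i, s i * s i = 1) {w : Γ}
    (hw : w ∈ Subgroup.closure (Set.range s)) : ∃ n, IsWord s n w := by
  induction hw using Subgroup.closure_induction'' with
  | one => exact ⟨0, isWord_zero.2 rfl⟩
  | mem x hx =>
    obtain ⟨i, rfl⟩ := hx
    exact ⟨1, isWord_generator i⟩
  | inv_mem x hx =>
    obtain ⟨i, rfl⟩ := hx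
    rw [inv_eq_of_mul_eq_one_left (hs i)]
    exact ⟨1, isWord_generator i⟩
  | mul x y _ _ hx hy =>
    obtain ⟨n, hn⟩ := hx
    obtain ⟨k, hk⟩ := hy
    exact ⟨_, hn.mul hk⟩

end Words

/-! ### Dihedral subgroups and the braid relation -/

namespace ReflectionSystem

variable {ι E : Type*} [MetricSpace E] {s : ι → E ≃ᵢ E} {F : ι → E → ℝ} {m : ι → ι → ℕ}

theorem mul_self (h : ReflectionSystem s F m) (i : ι) : s i * s i = 1 := by
  ext z
  refine h.separating _ _ fun j => ?_
  rw [IsometryEquiv.mul_apply, IsometryEquiv.coe_one, id]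
  by_cases hij : i = j
  · subst hij
    rw [h.apply_self, h.apply_self, neg_neg]
  · rw [h.apply_of_ne i j hij, h.apply_of_ne i j hij, h.apply_self]
    ring

theorem apply_alternating_self (h : ReflectionSystem s F m) (i j : ι) (k : ℕ) (z : E) :
    F i (alternating s i j (k + 1) z) = -F i (alternating s j i k z) := by
  rw [alternating, IsometryEquiv.mul_apply, h.apply_self]

theorem apply_alternating_add_two (h : ReflectionSystem s F m) {i j : ι} (hij : i ≠ j) (k : ℕ)
    (z : E) : F i (alternating s j i (k + 2) z) =
      2 * Real.cos (Real.pi / m i j) * F j (alternating s i j (k + 1) z)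
        - F i (alternating s j i k z) := by
  rw [alternating, IsometryEquiv.mul_apply, h.apply_of_ne j i hij.symm, h.apply_alternating_self,
    h.m_symm]
  ring

/-- On the span of `F i` and `F j` the product of the two reflections is a rotation of angle `2π / m
i j`, so the coefficients are quotients of sines. Both parities and both orders of `i`, `j` go
through one induction, driven by `sin (x + 2θ) = 2 cos θ sin (x + θ) - sin x`. -/
theorem apply_alternating (h : ReflectionSystem s F m) (z : E) (k : ℕ) : ∀ i j, i ≠ j →
    (Real.sin (Real.pi / m i j) * F i (alternating s j i (2 * k) z) =
      Real.sin ((2 * k + 1) * (Real.pi / m i j)) * F i z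
        + Real.sin (2 * k * (Real.pi / m i j)) * F j z) ∧
    (Real.sin (Real.pi / m i j) * F i (alternating s j i (2 * k + 1) z) =
      Real.sin ((2 * k + 2) * (Real.pi / m i j)) * F j z
        + Real.sin ((2 * k + 1) * (Real.pi / m i j)) * F i z) := by
  have step : ∀ x θ : ℝ, Real.sin (x + θ + θ) =
      2 * Real.cos θ * Real.sin (x + θ) - Real.sin x := fun x θ => by
    have := Real.sin_sub (x + θ) θ
    rw [add_sub_cancel_right] at this
    rw [Real.sin_add, this]
    ring
  induction k with
  | zero =>
    intro i j hij
    constructor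
    · simp [alternating]
    · simp only [alternating, mul_zero, zero_add, mul_one, CharP.cast_eq_zero, one_mul,
        h.apply_of_ne j i hij.symm, h.m_symm j i, Real.sin_two_mul]
      ring
  | succ k ih =>
    intro i j hij
    set θ := Real.pi / m i j with hθ
    obtain ⟨h1, h2⟩ := ih i j hij
    obtain ⟨h3, h4⟩ := ih j i hij.symm
    rw [h.m_symm j i, ← hθ] at h3 h4
    rw [← hθ] at h1 h2
    have e1 := step (2 * k * θ) θ
    have e2 := step ((2 * k + 1) * θ) θ
    have e3 := step ((2 * k + 2) * θ) θ
    have a1 : (2 * k + 1) * θ = 2 * k * θ + θ := by ring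
    have a2 : (2 * k + 2) * θ = 2 * k * θ + θ + θ := by ring
    have a3 : (2 * (k + 1 : ℕ) + 1) * θ = 2 * k * θ + θ + θ + θ := by push_cast; ring
    have a4 : (2 * (k + 1 : ℕ) + 2) * θ = 2 * k * θ + θ + θ + θ + θ := by push_cast; ring
    have a5 : 2 * (k + 1 : ℕ) * θ = 2 * k * θ + θ + θ := by push_cast; ring
    rw [a1] at h1 h2 h3 h4 e2
    rw [a2] at h2 h4 e3
    rw [a3, a4, a5]
    have key : ∀ i' j' : ι, i' ≠ j' → m i' j' = m i j →
      F i' (alternating s j' i' (2 * (k + 1)) z) =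
        2 * Real.cos θ * F j' (alternating s i' j' (2 * k + 1) z)
          - F i' (alternating s j' i' (2 * k) z) := fun i' j' hne hm => by
      rw [mul_add, mul_one, h.apply_alternating_add_two hne, hm, hθ]
    have k1 := key i j hij rfl
    have k2 := key j i hij.symm (h.m_symm j i)
    have k3 : F i (alternating s j i (2 * (k + 1) + 1) z) =
        2 * Real.cos θ * F j (alternating s i j (2 * (k + 1)) z)
          - F i (alternating s j i (2 * k + 1) z) := by
      rw [show 2 * (k + 1) + 1 = (2 * k + 1) + 2 by ring, h.apply_alternating_add_two hij, hθ]
      rfl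
    have r1 : Real.sin θ * F i (alternating s j i (2 * (k + 1)) z) =
        Real.sin (2 * k * θ + θ + θ + θ) * F i z + Real.sin (2 * k * θ + θ + θ) * F j z := by
      rw [k1, e2, e1]
      rw [e1] at h4
      linear_combination 2 * Real.cos θ * h4 - h1
    have r2 : Real.sin θ * F j (alternating s i j (2 * (k + 1)) z) =
        Real.sin (2 * k * θ + θ + θ + θ) * F j z + Real.sin (2 * k * θ + θ + θ) * F i z := by
      rw [k2, e2, e1]
      rw [e1] at h2
      linear_combination 2 * Real.cos θ * h2 - h3
    refine ⟨r1, ?_⟩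
    rw [k3, e3]
    linear_combination 2 * Real.cos θ * r2 - h2 - F i z * e2

theorem angle_pos (h : ReflectionSystem s F m) {i j : ι} (hij : i ≠ j) :
    0 < Real.pi / m i j ∧ m i j * (Real.pi / m i j) = Real.pi := by
  have : (0 : ℝ) < m i j := by exact_mod_cast (by norm_num : 0 < 2).trans_le (h.two_le_m i j hij)
  exact ⟨div_pos Real.pi_pos this, by field_simp⟩

theorem sin_angle_pos (h : ReflectionSystem s F m) {i j : ι} (hij : i ≠ j) :
    0 < Real.sin (Real.pi / m i j) := by
  have h2 : (2 : ℝ) ≤ m i j := by exact_mod_cast h.two_le_m i j hij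
  obtain ⟨h0, h1⟩ := h.angle_pos hij
  exact Real.sin_pos_of_pos_of_lt_pi h0 (by nlinarith)

/-- The chambers of a dihedral group reached by `j i j ⋯`, of fewer than `m i j` letters, are on
the positive side of the wall `i`. -/
theorem apply_alternating_pos (h : ReflectionSystem s F m) {i j : ι} (hij : i ≠ j) {z : E}
    (hi : 0 < F i z) (hj : 0 < F j z) {k : ℕ} (hk : k < m i j) :
    0 < F i (alternating s j i k z) := by
  obtain ⟨hθ, hm⟩ := h.angle_pos hij
  have hsin := h.sin_angle_pos hij
  set θ := Real.pi / m i j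
  have hkm : (k : ℝ) + 1 ≤ m i j := by exact_mod_cast hk
  have hle : (k + 1) * θ ≤ Real.pi := by rw [← hm]; gcongr
  refine pos_of_mul_pos_right (a := Real.sin θ) ?_ hsin.le
  have hk0 : (0 : ℝ) ≤ k := k.cast_nonneg
  have s1 : 0 ≤ Real.sin ((k + 1) * θ) := Real.sin_nonneg_of_nonneg_of_le_pi (by positivity) hle
  have s2 : 0 ≤ Real.sin (k * θ) := Real.sin_nonneg_of_nonneg_of_le_pi (by positivity) (by linarith)
  -- One of the sines may vanish, at `k = 0` or at `k + 1 = m i j`, but never both.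
  have s3 : 0 < Real.sin (k * θ) ∨ 0 < Real.sin ((k + 1) * θ) := by
    rcases Nat.eq_zero_or_pos k with rfl | hk
    · right; simpa using hsin
    · left
      have : (0 : ℝ) < k := by exact_mod_cast hk
      exact Real.sin_pos_of_pos_of_lt_pi (by positivity) (by linarith)
  rcases Nat.even_or_odd' k with ⟨l, rfl | rfl⟩
  · rw [(h.apply_alternating z l i j hij).1]
    push_cast at s1 s2 s3
    rcases s3 with s3 | s3
    · exact add_pos_of_nonneg_of_pos (mul_nonneg s1 hi.le) (mul_pos s3 hj)
    · exact add_pos_of_pos_of_nonneg (mul_pos s3 hi) (mul_nonneg s2 hj.le)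
  · rw [(h.apply_alternating z l i j hij).2]
    push_cast at s1 s2 s3
    rw [add_assoc, one_add_one_eq_two] at s1 s3
    rcases s3 with s3 | s3
    · exact add_pos_of_nonneg_of_pos (mul_nonneg s1 hj.le) (mul_pos s3 hi)
    · exact add_pos_of_pos_of_nonneg (mul_pos s3 hj) (mul_nonneg s2 hi.le)

/-- With `m i j = k + 1`, the sines of `k θ`, `(k + 1) θ`, `(k + 2) θ` are `sin θ`, `0`, `-sin θ`,
so both sides reduce to the same signed value of `F i` or `F j` at `z`. -/
theorem apply_alternating_m (h : ReflectionSystem s F m) {i j : ι} (hij : i ≠ j) (z : E) :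
    F i (alternating s i j (m i j) z) = F i (alternating s j i (m i j) z) := by
  obtain ⟨-, hm⟩ := h.angle_pos hij
  have hsin := h.sin_angle_pos hij
  have h2 := h.two_le_m i j hij
  obtain ⟨k, hk⟩ : ∃ k, m i j = k + 1 := ⟨m i j - 1, by omega⟩
  set θ := Real.pi / m i j with hθ
  refine mul_left_cancel₀ hsin.ne' ?_
  rw [hk, h.apply_alternating_self]
  rw [hk] at hm
  have s0 : Real.sin ((k + 1) * θ) = 0 := by
    rw [← Real.sin_pi, ← hm]; push_cast; rfl
  have s1 : Real.sin (k * θ) = Real.sin θ := by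
    rw [← Real.sin_pi_sub θ, ← hm]; push_cast; ring_nf
  have s2 : Real.sin ((k + 2) * θ) = -Real.sin θ := by
    rw [← Real.sin_add_pi, ← hm]; push_cast; ring_nf
  rcases Nat.even_or_odd' k with ⟨l, rfl | rfl⟩
  · have h1 := h.apply_alternating z l i j hij
    rw [← hθ] at h1
    push_cast at s0 s1 s2
    rw [mul_neg, h1.1, h1.2, s0, s1, s2]
    ring
  · have h1 := h.apply_alternating z l i j hij
    have h3 := h.apply_alternating z (l + 1) i j hij
    rw [← hθ] at h1 h3
    push_cast at s0 s1 s2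
    rw [mul_neg, h1.2, show 2 * l + 1 + 1 = 2 * (l + 1) by ring, h3.1]
    push_cast
    rw [show (2 * (l : ℝ) + 2) = 2 * l + 1 + 1 by ring, s0, s1,
      show (2 * ((l : ℝ) + 1) + 1) = 2 * l + 1 + 2 by ring, s2,
      show (2 * ((l : ℝ) + 1)) = 2 * l + 1 + 1 by ring, s0]
    ring

/-- The braid relation. -/
theorem alternating_m (h : ReflectionSystem s F m) {i j : ι} (hij : i ≠ j) :
    alternating s i j (m i j) = alternating s j i (m i j) := by
  have hi := h.apply_alternating_m hij
  have hj := h.apply_alternating_m hij.symm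
  ext z
  refine h.separating _ _ fun k => ?_
  by_cases hki : i = k
  · subst hki; exact hi z
  by_cases hkj : j = k
  · subst hkj; rw [h.m_symm i j]; exact (hj z).symm
  have hsin := h.sin_angle_pos hij
  set c := Real.cos (Real.pi / m i j) with hc
  have hc1 : 1 - c ^ 2 ≠ 0 := by
    have := Real.sin_sq_add_cos_sq (Real.pi / m i j)
    rw [← hc] at this
    have : 1 - c ^ 2 = Real.sin (Real.pi / m i j) ^ 2 := by linarith
    rw [this]; positivity
  set a := Real.cos (Real.pi / m i k)
  set b := Real.cos (Real.pi / m j k)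
  -- These equations make `F k + α F i + β F j` invariant under `s i` and `s j`. They are solvable
  -- because the determinant `1 - c²` is a nonzero squared sine. Agreement of `F i` and `F j` then
  -- forces agreement of `F k`.
  obtain ⟨α, β, h1, h2⟩ : ∃ α β : ℝ, a - α + β * c = 0 ∧ b - β + α * c = 0 :=
    ⟨(a + b * c) / (1 - c ^ 2), (b + a * c) / (1 - c ^ 2), by field_simp; ring, by field_simp; ring⟩
  have inv_i : ∀ y, F k (s i y) + α * F i (s i y) + β * F j (s i y) =
      F k y + α * F i y + β * F j y := fun y => by
    rw [h.apply_self, h.apply_of_ne i k hki, h.apply_of_ne i j hij]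
    linear_combination 2 * F i y * h1
  have inv_j : ∀ y, F k (s j y) + α * F i (s j y) + β * F j (s j y) =
      F k y + α * F i y + β * F j y := fun y => by
    rw [h.apply_self, h.apply_of_ne j k hkj, h.apply_of_ne j i hij.symm, h.m_symm j i]
    linear_combination 2 * F j y * h2
  have inv_alt : ∀ n, (F k (alternating s i j n z) + α * F i (alternating s i j n z) +
        β * F j (alternating s i j n z) = F k z + α * F i z + β * F j z) ∧
      (F k (alternating s j i n z) + α * F i (alternating s j i n z) +
        β * F j (alternating s j i n z) = F k z + α * F i z + β * F j z) := by
    intro n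
    induction n with
    | zero => simp [alternating]
    | succ n ih =>
      simp only [alternating, IsometryEquiv.mul_apply]
      rw [inv_i, inv_j]
      exact ih.symm
  obtain ⟨e1, e2⟩ := inv_alt (m i j)
  have e3 := hi z
  have e4 := hj z
  rw [h.m_symm j i] at e4
  linear_combination e1 - e2 - α * e3 + β * e4

/-! ### Tits' induction on word length -/

theorem mul_mul_self (h : ReflectionSystem s F m) (i : ι) (w : E ≃ᵢ E) : s i * (s i * w) = w := by
  rw [← mul_assoc, h.mul_self, one_mul]

/-- Each `w` is on one side of each wall, and the negative side means that its word length is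
decreased by the reflection; and each `w` splits as an element of a given dihedral group followed by
one in the positive sector. -/
theorem side_and_splitting (h : ReflectionSystem s F m) (n : ℕ) :
    (∀ w, IsWordLength s n w → ∀ i, (∀ z, (∀ j, 0 < F j z) → 0 < F i (w z)) ∨
      ((∀ z, (∀ j, 0 < F j z) → F i (w z) < 0) ∧ ∃ k, n = k + 1 ∧ IsWord s k (s i * w))) ∧
    (∀ w, IsWordLength s n w → ∀ i j, i ≠ j → ∃ k l v, n = k + l ∧ k ≤ m i j ∧ IsWord s l v ∧
      (w = alternating s i j k * v ∨ w = alternating s j i k * v) ∧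
      ∀ z, (∀ x, 0 < F x z) → 0 < F i (v z) ∧ 0 < F j (v z)) := by
  induction n with
  | zero =>
    constructor
    · intro w hw i
      rw [isWord_zero.1 hw.1]
      exact Or.inl fun z hz => hz i
    · intro w hw i j _
      exact ⟨0, 0, w, rfl, Nat.zero_le _, hw.1, Or.inl (one_mul w).symm, fun z hz => by
        rw [isWord_zero.1 hw.1]; exact ⟨hz i, hz j⟩⟩
  | succ n ih =>
    obtain ⟨ihP, ihQ⟩ := ih
    have hP : ∀ w, IsWordLength s (n + 1) w → ∀ i, (∀ z, (∀ j, 0 < F j z) → 0 < F i (w z)) ∨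
        ((∀ z, (∀ j, 0 < F j z) → F i (w z) < 0) ∧
          ∃ k, n + 1 = k + 1 ∧ IsWord s k (s i * w)) := by
      intro w hw i
      obtain ⟨t, w', hw', rfl⟩ := hw.1.exists_eq_mul
      have hl := hw.of_mul hw' rfl
      by_cases hit : i = t
      · subst hit
        rcases ihP w' hl i with hp | ⟨-, k, rfl, hk⟩
        · refine Or.inr ⟨fun z hz => ?_, n, rfl, by rwa [h.mul_mul_self]⟩
          rw [IsometryEquiv.mul_apply, h.apply_self]
          exact neg_neg_of_pos (hp z hz)
        · have := hw.2 _ hk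
          omega
      · obtain ⟨k, l, v, hn, hkm, hv, hsplit, hpos⟩ := ihQ w' hl i t hit
        -- If the dihedral part of `w'` began with `t`, that letter would cancel in `s t * w'`,
        -- against minimality.
        have hsplit' : w' = alternating s i t k * v := by
          rcases hsplit with h1 | h1
          · exact h1
          · rcases k with _ | k
            · exact h1
            · have h3 : s t * w' = alternating s i t k * v := by
                rw [h1, alternating, mul_assoc, h.mul_mul_self]
              have := hw.2 _ (h3 ▸ (isWord_alternating k i t).mul hv)
              omega
        have h2 := h.two_le_m i t hit
        -- At `k = m i t` the braid relation lets the dihedral part begin with `t`, and the same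
        -- cancellation occurs.
        have hkm' : k < m i t := by
          refine lt_of_le_of_ne hkm fun hk => ?_
          have h1 : s t * w' = alternating s i t (k - 1) * v := by
            obtain ⟨k, rfl⟩ : ∃ k', k = k' + 1 := ⟨k - 1, by omega⟩
            rw [hsplit', hk, h.alternating_m hit, ← hk, alternating, mul_assoc, h.mul_mul_self]
            rfl
          have := hw.2 _ (h1 ▸ (isWord_alternating (k - 1) i t).mul hv)
          omega
        have hw_eq : s t * w' = alternating s t i (k + 1) * v := by
          rw [hsplit', alternating, mul_assoc]
        -- The dihedral part of `s t * w'` now has `k + 1 ≤ m i t` letters and begins with `t`.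
        -- Below `m i t` it keeps the sector on the positive side of `i`; at `m i t` the braid
        -- relation brings `i` to the front, so `s i` shortens the word.
        rcases Nat.lt_or_ge (k + 1) (m i t) with hk | hk
        · refine Or.inl fun z hz => ?_
          rw [hw_eq, IsometryEquiv.mul_apply]
          exact h.apply_alternating_pos hit (hpos z hz).1 (hpos z hz).2 hk
        · have hk' : k + 1 = m i t := by omega
          have hw_eq' : s t * w' = s i * (alternating s t i k * v) := by
            rw [hw_eq, hk', ← h.alternating_m hit, ← hk', alternating, mul_assoc]
          refine Or.inr ⟨fun z hz => ?_, n, rfl, ?_⟩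
          · rw [hw_eq', IsometryEquiv.mul_apply, h.apply_self, IsometryEquiv.mul_apply]
            exact neg_neg_of_pos
              (h.apply_alternating_pos hit (hpos z hz).1 (hpos z hz).2 hkm')
          · rw [hw_eq', h.mul_mul_self, hn]
            exact (isWord_alternating k t i).mul hv
    refine ⟨hP, fun w hw i j hij => ?_⟩
    have key : ∀ i j, i ≠ j →
        (∃ k, n + 1 = k + 1 ∧ IsWord s k (s i * w)) → ∃ k l v, n + 1 = k + l ∧ k ≤ m i j ∧
        IsWord s l v ∧ w = alternating s i j k * v ∧
        ∀ z, (∀ x, 0 < F x z) → 0 < F i (v z) ∧ 0 < F j (v z) := by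
      rintro i j hij ⟨n', hn', hword⟩
      obtain rfl : n = n' := by omega
      have hl := hw.of_mul hword (h.mul_mul_self i w).symm
      obtain ⟨k, l, v, hn, hkm, hv, hsplit, hpos⟩ := ihQ _ hl i j hij
      -- The dihedral part of the shorter element `s i * w` cannot begin with `i`, since `w` would
      -- then have a word of length below `n + 1`. Hence `s i` can be put in front of it, and by the
      -- braid relation the result has at most `m i j` letters.
      have hcase : ∀ k', k = k' + 1 → s i * w ≠ alternating s i j k * v := by
        rintro k' rfl heq
        have h1 : w = alternating s j i k' * v := by
          rw [alternating, mul_assoc] at heq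
          exact mul_left_cancel heq
        have := hw.2 _ (h1 ▸ (isWord_alternating k' j i).mul hv)
        omega
      have hsplit' : s i * w = alternating s j i k * v := by
        rcases hsplit with h1 | h1
        · rcases Nat.eq_zero_or_pos k with rfl | hk
          · exact h1
          · exact absurd h1 (hcase (k - 1) (by omega))
        · exact h1
      have h2 := h.two_le_m i j hij
      refine ⟨k + 1, l, v, by omega, ?_, hv, ?_, hpos⟩
      · refine lt_of_le_of_ne hkm fun hk => hcase (k - 1) (by omega) ?_
        rw [hsplit', hk, h.alternating_m hij]
      · rw [alternating, mul_assoc, ← hsplit', h.mul_mul_self]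
    rcases hP w hw i with hi | ⟨-, hi⟩
    · rcases hP w hw j with hj | ⟨-, hj⟩
      · exact ⟨0, n + 1, w, (zero_add _).symm, Nat.zero_le _, hw.1, Or.inl (one_mul w).symm,
          fun z hz => ⟨hi z hz, hj z hz⟩⟩
      · obtain ⟨k, l, v, h1, h2, h3, h4, h5⟩ := key j i hij.symm hj
        exact ⟨k, l, v, h1, h.m_symm i j ▸ h2, h3, Or.inr h4, fun z hz => (h5 z hz).symm⟩
    · obtain ⟨k, l, v, h1, h2, h3, h4, h5⟩ := key i j hij hi
      exact ⟨k, l, v, h1, h2, h3, Or.inl h4, h5⟩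

/-- The translates of the open chamber are disjoint. -/
theorem eq_one_of_chamber (h : ReflectionSystem s F m) {w : E ≃ᵢ E}
    (hw : w ∈ Subgroup.closure (Set.range s)) {z : E} (hz : ∀ i, 0 < F i z)
    (hwz : ∀ i, 0 < F i (w z)) : w = 1 := by
  obtain ⟨k, hk⟩ := exists_isWord_of_mem_closure h.mul_self hw
  obtain ⟨n, hn⟩ := exists_isWordLength hk
  rcases n with _ | n
  · exact isWord_zero.1 hn.1
  · exfalso
    obtain ⟨i, v, hv, rfl⟩ := hn.1.exists_eq_mul
    rcases (h.side_and_splitting n).1 v (hn.of_mul hv rfl) i with hp | ⟨-, k, rfl, hk⟩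
    · have h1 := hp z hz
      have h2 := hwz i
      rw [IsometryEquiv.mul_apply, h.apply_self] at h2
      linarith
    · have := hn.2 _ hk
      omega

/-- Two translates of the open chamber that share a point are equal. -/
theorem eq_of_chamber (h : ReflectionSystem s F m) {v w : E ≃ᵢ E}
    (hv : v ∈ Subgroup.closure (Set.range s)) (hw : w ∈ Subgroup.closure (Set.range s)) {y z : E}
    (hy : ∀ i, 0 < F i y) (hz : ∀ i, 0 < F i z) (hvw : v y = w z) : v = w := by
  have h1 : (w⁻¹ * v) y = z := by
    rw [IsometryEquiv.mul_apply, hvw, IsometryEquiv.inv_apply_self]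
  have := h.eq_one_of_chamber (mul_mem (inv_mem hw) hv) hy (fun i => by rw [h1]; exact hz i)
  exact (inv_mul_eq_one.1 this).symm

/-! ### Discreteness of orbits and the covering property -/

/-- Take a ball about `x` inside the open chamber: if `w⁻¹ (v x)` lies in it, two translates of the
chamber meet. The uniform `ε` serves both the finiteness argument for the covering and the
discreteness of the group. -/
theorem exists_eq_of_dist_lt [Finite ι] (h : ReflectionSystem s F m) (hF : ∀ i, Continuous (F i))
    {x : E} (hx : ∀ i, 0 < F i x) : ∃ ε > 0, ∀ v ∈ Subgroup.closure (Set.range s),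
      ∀ w ∈ Subgroup.closure (Set.range s), dist (v x) (w x) < ε → v = w := by
  have hopen : IsOpen {z | ∀ i, 0 < F i z} := by
    rw [Set.ofPred_forall]
    exact isOpen_iInter_of_finite fun i => isOpen_lt continuous_const (hF i)
  obtain ⟨ε, hε, hball⟩ := Metric.isOpen_iff.1 hopen x hx
  refine ⟨ε, hε, fun v hv w hw hd => ?_⟩
  have h1 : w⁻¹ (v x) ∈ Metric.ball x ε := by
    rw [Metric.mem_ball, ← w.isometry.dist_eq, IsometryEquiv.apply_inv_self]
    exact hd
  refine h.eq_of_chamber hv hw hx (hball h1) ?_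
  rw [IsometryEquiv.apply_inv_self]

/-- The translates of the closed chamber cover the space, when reflecting a point that is separated
by a wall from a chamber point `x` brings it nearer to `x`. -/
theorem exists_mem_closed_chamber [Finite ι] [ProperSpace E] (h : ReflectionSystem s F m)
    (hF : ∀ i, Continuous (F i)) {x : E} (hx : ∀ i, 0 < F i x)
    (hdist : ∀ i z, F i z < 0 → dist (s i z) x < dist z x) (z : E) :
    ∃ w ∈ Subgroup.closure (Set.range s), ∀ i, 0 ≤ F i (w z) := by
  obtain ⟨ε, hε, hsep⟩ := h.exists_eq_of_dist_lt hF hx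
  set W := Subgroup.closure (Set.range s)
  -- Only these elements compete for the nearest point of the orbit of `z`. Their images of `x` are
  -- distinct, `ε`-separated and within `2 * dist z x` of `x`, hence finite in number in a proper
  -- space.
  set S : Set (E ≃ᵢ E) := {w | w ∈ W ∧ dist (w z) x ≤ dist z x} with hS
  have hfin : S.Finite := by
    have hsep' : (((fun w : E ≃ᵢ E => w x) '' S)).Pairwise fun a b => ε ≤ dist a b := by
      rintro _ ⟨v, hv, rfl⟩ _ ⟨w, hw, rfl⟩ hne
      by_contra! hlt
      exact hne (by rw [hsep v hv.1 w hw.1 hlt])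
    have hinj : Set.InjOn (fun w : E ≃ᵢ E => w x) S := fun v hv w hw hvw =>
      hsep v hv.1 w hw.1 (by rw [show v x = w x from hvw, dist_self]; exact hε)
    have hclosed := Metric.isClosed_of_pairwise_le_dist hε hsep'
    have hbdd : Bornology.IsBounded ((fun w : E ≃ᵢ E => w x) '' S) := by
      refine (Metric.isBounded_closedBall (x := x) (r := dist z x + dist z x)).subset ?_
      rintro _ ⟨w, hw, rfl⟩
      rw [Metric.mem_closedBall]
      calc dist (w x) x ≤ dist (w x) (w z) + dist (w z) x := dist_triangle _ _ _
        _ ≤ dist z x + dist z x := by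
          rw [w.isometry.dist_eq, dist_comm x z]; exact add_le_add_right hw.2 _
    have hcomp := Metric.isCompact_of_isClosed_isBounded hclosed hbdd
    have hdisc : IsDiscrete ((fun w : E ≃ᵢ E => w x) '' S) := by
      rw [isDiscrete_iff_discreteTopology, discreteTopology_subtype_iff']
      refine fun y hy => ⟨Metric.ball y ε, Metric.isOpen_ball, ?_⟩
      refine Set.eq_singleton_iff_unique_mem.2 ⟨⟨Metric.mem_ball_self hε, hy⟩, fun y' hy' => ?_⟩
      by_contra hne
      exact absurd (Metric.mem_ball.1 hy'.1) (not_lt.2 (hsep' hy'.2 hy hne))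
    exact Set.Finite.of_finite_image (hcomp.finite hdisc) hinj
  obtain ⟨w, hw, hmin⟩ := Set.exists_min_image S (fun w => dist (w z) x) hfin ⟨1, one_mem _, le_rfl⟩
  refine ⟨w, hw.1, fun i => ?_⟩
  by_contra! hneg
  have hlt := hdist i _ hneg
  have := hmin (s i * w) ⟨mul_mem (Subgroup.subset_closure ⟨i, rfl⟩) hw.1, hlt.le.trans hw.2⟩
  exact absurd hlt (not_lt.2 this)

end ReflectionSystem

/-! ### Coordinates on the hyperboloid

The point `x + y i` is represented by the positive definite matrix `!![x² + y², x; x, 1] / y` of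
determinant one. Isometries act linearly on these matrices. -/

/-- The upper left entry of the matrix of `z`. -/
noncomputable def coordA (z : ℍ) : ℝ := (z.re ^ 2 + z.im ^ 2) / z.im

/-- The off-diagonal entry of the matrix of `z`. -/
noncomputable def coordB (z : ℍ) : ℝ := z.re / z.im

/-- The lower right entry of the matrix of `z`. -/
noncomputable def coordC (z : ℍ) : ℝ := 1 / z.im

theorem coord_det (z : ℍ) : coordA z * coordC z - coordB z ^ 2 = 1 := by
  have := z.im_pos.ne'
  simp only [coordA, coordB, coordC]
  field_simp
  ring

theorem coordC_pos (z : ℍ) : 0 < coordC z := one_div_pos.2 z.im_pos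

theorem coordA_pos (z : ℍ) : 0 < coordA z := by
  have := z.im_pos
  unfold coordA
  positivity

theorem ext_coord {z w : ℍ} (hB : coordB z = coordB w) (hC : coordC z = coordC w) : z = w := by
  have hz := z.im_pos.ne'
  have hw := w.im_pos.ne'
  have him : z.im = w.im := by
    simp only [coordC] at hC
    field_simp at hC
    exact hC.symm
  refine UpperHalfPlane.ext_re_im ?_ him
  simp only [coordB, him] at hB
  field_simp at hB
  exact hB

theorem exists_coord {A B C : ℝ} (hC : 0 < C) (hdet : A * C - B ^ 2 = 1) :
    ∃ z : ℍ, coordA z = A ∧ coordB z = B ∧ coordC z = C := by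
  refine ⟨⟨⟨B / C, 1 / C⟩, one_div_pos.2 hC⟩, ?_, ?_, ?_⟩ <;>
    simp only [coordA, coordB, coordC, UpperHalfPlane.re, UpperHalfPlane.im]
  · field_simp
    linarith
  · field_simp
  · field_simp

@[fun_prop]
theorem continuous_coordA : Continuous coordA := by
  unfold coordA
  exact ((continuous_re.pow 2).add (continuous_im.pow 2)).div continuous_im fun z => z.im_pos.ne'

@[fun_prop]
theorem continuous_coordB : Continuous coordB :=
  continuous_re.div continuous_im fun z => z.im_pos.ne'

@[fun_prop]
theorem continuous_coordC : Continuous coordC :=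
  continuous_const.div continuous_im fun z => z.im_pos.ne'

/-- The right side is the polarization of the determinant: the Lorentzian form for which `ℍ` is a
sheet of a hyperboloid. -/
theorem cosh_dist_coord (z w : ℍ) : Real.cosh (dist z w) =
    (coordA z * coordC w + coordC z * coordA w - 2 * coordB z * coordB w) / 2 := by
  have hz := z.im_pos.ne'
  have hw := w.im_pos.ne'
  rw [cosh_dist, Complex.dist_eq, Complex.sq_norm, Complex.normSq_apply]
  simp only [Complex.sub_re, Complex.sub_im, coe_re, coe_im, coordA, coordB, coordC]
  field_simp
  ring

theorem re_im_smul (g : Matrix.SpecialLinearGroup (Fin 2) ℝ) (z : ℍ) :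
    (g • z).re = ((g 0 0 * z.re + g 0 1) * (g 1 0 * z.re + g 1 1) + g 0 0 * g 1 0 * z.im ^ 2) /
      ((g 1 0 * z.re + g 1 1) ^ 2 + (g 1 0 * z.im) ^ 2) ∧
    (g • z).im = z.im / ((g 1 0 * z.re + g 1 1) ^ 2 + (g 1 0 * z.im) ^ 2) := by
  have hd : g 0 0 * g 1 1 - g 0 1 * g 1 0 = 1 := by
    have := g.2
    rwa [Matrix.det_fin_two] at this
  have h := coe_specialLinearGroup_apply g z
  simp only [Algebra.algebraMap_self, RingHom.id_apply] at h
  have hre := congrArg Complex.re h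
  have him := congrArg Complex.im h
  rw [Complex.div_re] at hre
  rw [Complex.div_im] at him
  simp only [Complex.normSq_apply, Complex.add_re, Complex.add_im, Complex.mul_re, Complex.mul_im,
    Complex.ofReal_re, Complex.ofReal_im, coe_re, coe_im, zero_mul, sub_zero, add_zero] at hre him
  constructor
  · rw [hre, ← add_div]
    congr 1 <;> ring
  · rw [him, ← sub_div]
    congr 1
    · linear_combination z.im * hd
    · ring

/-- The matrix `M` of `z` transforms to `g M gᵀ`. The upper left entry is recovered from the other
two by the determinant condition. -/
theorem coord_smul (g : Matrix.SpecialLinearGroup (Fin 2) ℝ) (z : ℍ) :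
    coordA (g • z) = g 0 0 ^ 2 * coordA z + 2 * g 0 0 * g 0 1 * coordB z + g 0 1 ^ 2 * coordC z ∧
    coordB (g • z) = g 0 0 * g 1 0 * coordA z + (g 0 0 * g 1 1 + g 0 1 * g 1 0) * coordB z
      + g 0 1 * g 1 1 * coordC z ∧
    coordC (g • z) = g 1 0 ^ 2 * coordA z + 2 * g 1 0 * g 1 1 * coordB z + g 1 1 ^ 2 * coordC z := by
  have hz := z.im_pos.ne'
  obtain ⟨h1, h2⟩ := re_im_smul g z
  have hd : g 0 0 * g 1 1 - g 0 1 * g 1 0 = 1 := by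
    have := g.2
    rwa [Matrix.det_fin_two] at this
  have hD : (g 1 0 * z.re + g 1 1) ^ 2 + (g 1 0 * z.im) ^ 2 ≠ 0 := by
    intro h0
    rw [h0, div_zero] at h2
    exact (g • z).im_pos.ne' h2
  have hB : coordB (g • z) = g 0 0 * g 1 0 * coordA z + (g 0 0 * g 1 1 + g 0 1 * g 1 0) * coordB z
      + g 0 1 * g 1 1 * coordC z := by
    rw [coordB, h1, h2, div_div_div_cancel_right₀ hD]
    simp only [coordA, coordB, coordC]
    field_simp
    ring
  have hC : coordC (g • z) =
      g 1 0 ^ 2 * coordA z + 2 * g 1 0 * g 1 1 * coordB z + g 1 1 ^ 2 * coordC z := by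
    rw [coordC, h2, one_div_div]
    simp only [coordA, coordB, coordC]
    field_simp
    ring
  refine ⟨?_, hB, hC⟩
  have e1 := coord_det (g • z)
  have e2 := coord_det z
  have hC0 := (coordC_pos (g • z)).ne'
  refine mul_right_cancel₀ hC0 ?_
  rw [show coordA (g • z) * coordC (g • z) = 1 + coordB (g • z) ^ 2 by linarith, hB, hC]
  linear_combination (-1) * (g 0 0 * g 1 1 - g 0 1 * g 1 0) ^ 2 * e2
    - (g 0 0 * g 1 1 - g 0 1 * g 1 0 + 1) * hd

theorem coord_I : coordA UpperHalfPlane.I = 1 ∧ coordB UpperHalfPlane.I = 0 ∧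
    coordC UpperHalfPlane.I = 1 := by
  simp [coordA, coordB, coordC]

theorem coord_diagMat (t : ℝ) (z : ℍ) : coordA (diagMat t • z) = Real.exp t * coordA z ∧
    coordB (diagMat t • z) = coordB z ∧ coordC (diagMat t • z) = Real.exp (-t) * coordC z := by
  obtain ⟨h1, h2, h3⟩ := coord_smul (diagMat t) z
  have e1 : Real.exp t = Real.exp (t / 2) ^ 2 := by rw [← Real.exp_nat_mul]; congr 1; push_cast; ring
  have e2 : Real.exp (-t) = Real.exp (-(t / 2)) ^ 2 := by
    rw [← Real.exp_nat_mul]; congr 1; push_cast; ring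
  have e3 : Real.exp (t / 2) * Real.exp (-(t / 2)) = 1 := by rw [← Real.exp_add]; simp
  simp only [diagMat, Matrix.SpecialLinearGroup.coe_mk, Matrix.of_apply, Matrix.cons_val] at h1 h2 h3
  refine ⟨?_, ?_, ?_⟩
  · rw [diagMat, h1, e1]; ring
  · rw [diagMat, h2, e3]; ring
  · rw [diagMat, h3, e2]; ring

theorem coord_quarterTurn (z : ℍ) :
    coordA (rotMat (Real.pi / 4) • z) = (coordA z - 2 * coordB z + coordC z) / 2 ∧
    coordB (rotMat (Real.pi / 4) • z) = (coordA z - coordC z) / 2 ∧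
    coordC (rotMat (Real.pi / 4) • z) = (coordA z + 2 * coordB z + coordC z) / 2 := by
  obtain ⟨h1, h2, h3⟩ := coord_smul (rotMat (Real.pi / 4)) z
  have e := Real.sq_sqrt (show (0 : ℝ) ≤ 2 by norm_num)
  simp only [rotMat, Matrix.SpecialLinearGroup.coe_mk, Matrix.of_apply, Matrix.cons_val,
    Real.cos_pi_div_four, Real.sin_pi_div_four] at h1 h2 h3
  refine ⟨?_, ?_, ?_⟩
  · simp only [rotMat, Real.cos_pi_div_four, Real.sin_pi_div_four]
    rw [h1]; linear_combination (coordA z - 2 * coordB z + coordC z) / 4 * e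
  · simp only [rotMat, Real.cos_pi_div_four, Real.sin_pi_div_four]
    rw [h2]; linear_combination (coordA z - coordC z) / 4 * e
  · simp only [rotMat, Real.cos_pi_div_four, Real.sin_pi_div_four]
    rw [h3]; linear_combination (coordA z + 2 * coordB z + coordC z) / 4 * e

/-- Polar coordinates about `i`. -/
theorem coord_polar (θ t : ℝ) :
    coordA (rotMat θ • diagMat t • UpperHalfPlane.I) =
      Real.cosh t + Real.sinh t * Real.cos (2 * θ) ∧
    coordB (rotMat θ • diagMat t • UpperHalfPlane.I) = Real.sinh t * Real.sin (2 * θ) ∧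
    coordC (rotMat θ • diagMat t • UpperHalfPlane.I) =
      Real.cosh t - Real.sinh t * Real.cos (2 * θ) := by
  obtain ⟨h1, h2, h3⟩ := coord_smul (rotMat θ) (diagMat t • UpperHalfPlane.I)
  obtain ⟨d1, d2, d3⟩ := coord_diagMat t UpperHalfPlane.I
  obtain ⟨i1, i2, i3⟩ := coord_I
  have g00 : rotMat θ 0 0 = Real.cos θ := rfl
  have g01 : rotMat θ 0 1 = -Real.sin θ := rfl
  have g10 : rotMat θ 1 0 = Real.sin θ := rfl
  have g11 : rotMat θ 1 1 = Real.cos θ := rfl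
  rw [h1, h2, h3, d1, d2, d3, i1, i2, i3, g00, g01, g10, g11, Real.sin_two_mul, Real.cos_two_mul,
    Real.cosh_eq, Real.sinh_eq]
  have := Real.sin_sq_add_cos_sq θ
  refine ⟨?_, ?_, ?_⟩
  · linear_combination Real.exp (-t) * this
  · ring
  · linear_combination Real.exp t * this

/-! ### Segments and triangles in coordinates -/

/-- Determinant one for `z` forces `sinh (dist a z) = k sinh (dist a b)` and `sinh (dist z b) = l
sinh (dist a b)`; the addition formula for `cosh` then makes the distances add up. -/
theorem mem_segment_of_coord {a b z : ℍ} {l k : ℝ} (hl : 0 ≤ l) (hk : 0 ≤ k)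
    (hA : coordA z = l * coordA a + k * coordA b) (hB : coordB z = l * coordB a + k * coordB b)
    (hC : coordC z = l * coordC a + k * coordC b) : z ∈ segment a b := by
  have da := coord_det a
  have db := coord_det b
  have dz := coord_det z
  have c1 := cosh_dist_coord a z
  have c2 := cosh_dist_coord z b
  have c3 := cosh_dist_coord a b
  set c := Real.cosh (dist a b)
  rw [hA, hB, hC] at c1 c2 dz
  have e1 : Real.cosh (dist a z) = l + k * c := by rw [c1, c3]; linear_combination l * da
  have e2 : Real.cosh (dist z b) = l * c + k := by rw [c2, c3]; linear_combination k * db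
  have e0 : l ^ 2 + k ^ 2 + 2 * l * k * c = 1 := by
    rw [c3]; linear_combination dz - l ^ 2 * da - k ^ 2 * db
  have q := Real.cosh_sq (dist a b)
  have s0 : 0 ≤ Real.sinh (dist a b) := Real.sinh_nonneg_iff.2 dist_nonneg
  have s1 : Real.sinh (dist a z) = k * Real.sinh (dist a b) := by
    have := Real.cosh_sq (dist a z)
    rw [e1] at this
    refine (sq_eq_sq₀ (Real.sinh_nonneg_iff.2 dist_nonneg) (by positivity)).1 ?_
    linear_combination k ^ 2 * q - this + e0
  have s2 : Real.sinh (dist z b) = l * Real.sinh (dist a b) := by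
    have := Real.cosh_sq (dist z b)
    rw [e2] at this
    refine (sq_eq_sq₀ (Real.sinh_nonneg_iff.2 dist_nonneg) (by positivity)).1 ?_
    linear_combination l ^ 2 * q - this + e0
  change dist a z + dist z b = dist a b
  have : Real.cosh (dist a z + dist z b) = Real.cosh (dist a b) := by
    rw [Real.cosh_add, e1, e2, s1, s2]
    linear_combination c * e0 - l * k * q
  rw [← Real.arcosh_cosh (by positivity : 0 ≤ dist a z + dist z b), this,
    Real.arcosh_cosh dist_nonneg]

theorem exists_coord_of_mem_segment {a b z : ℍ} (h : z ∈ segment a b) : ∃ l k : ℝ, 0 ≤ l ∧ 0 ≤ k ∧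
    coordA z = l * coordA a + k * coordA b ∧ coordB z = l * coordB a + k * coordB b ∧
    coordC z = l * coordC a + k * coordC b := by
  change dist a z + dist z b = dist a b at h
  rcases eq_or_lt_of_le (dist_nonneg (x := a) (y := b)) with h0 | h0
  · rw [← h0] at h
    have : a = z := dist_le_zero.1 (by linarith [dist_nonneg (x := z) (y := b)])
    subst this
    exact ⟨1, 0, zero_le_one, le_rfl, by ring, by ring, by ring⟩
  have hs : 0 < Real.sinh (dist a b) := Real.sinh_pos_iff.2 h0
  set l := Real.sinh (dist z b) / Real.sinh (dist a b) with hl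
  set k := Real.sinh (dist a z) / Real.sinh (dist a b) with hk
  have da := coord_det a
  have db := coord_det b
  have dz := coord_det z
  have c1 := cosh_dist_coord a z
  have c2 := cosh_dist_coord z b
  have c3 := cosh_dist_coord a b
  have e1 : Real.cosh (dist a z) = l + k * Real.cosh (dist a b) := by
    have := Real.sinh_sub (dist a b) (dist a z)
    rw [show dist a b - dist a z = dist z b by linarith] at this
    rw [hl, hk, this]; field_simp; ring
  have e2 : Real.cosh (dist z b) = l * Real.cosh (dist a b) + k := by
    have := Real.sinh_sub (dist a b) (dist z b)
    rw [show dist a b - dist z b = dist a z by linarith] at this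
    rw [hl, hk, this]; field_simp; ring
  have e3 : l * Real.cosh (dist a z) + k * Real.cosh (dist z b) = 1 := by
    have := Real.sinh_add (dist a z) (dist z b)
    rw [h] at this
    rw [hl, hk]; field_simp; rw [this]; ring
  have hl0 : 0 ≤ l := div_nonneg (Real.sinh_nonneg_iff.2 dist_nonneg) hs.le
  have hk0 : 0 ≤ k := div_nonneg (Real.sinh_nonneg_iff.2 dist_nonneg) hs.le
  clear_value l k
  -- The difference `(u, v, w)` is orthogonal to `a` (`o1`) and null (`o2`). The form is definite on
  -- the orthogonal complement of the timelike vector `a`, which `o3` expresses as a sum of two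
  -- squares, so the difference vanishes.
  obtain ⟨u, hu⟩ : ∃ u, u = coordA z - l * coordA a - k * coordA b := ⟨_, rfl⟩
  obtain ⟨v, hv⟩ : ∃ v, v = coordB z - l * coordB a - k * coordB b := ⟨_, rfl⟩
  obtain ⟨w, hw⟩ : ∃ w, w = coordC z - l * coordC a - k * coordC b := ⟨_, rfl⟩
  have o1 : u * coordC a + w * coordA a - 2 * v * coordB a = 0 := by
    rw [hu, hv, hw]
    linear_combination 2 * e1 - 2 * c1 + 2 * k * c3 - 2 * l * da
  have o2 : u * w - v ^ 2 = 0 := by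
    rw [hu, hv, hw]
    rw [c1, c2] at e3
    rw [c1, c3] at e1
    rw [c2, c3] at e2
    linear_combination dz + l ^ 2 * da + k ^ 2 * db - e3 - l * e1 - k * e2
  have hC := coordC_pos a
  have o3 : (coordC a * u - coordB a * v) ^ 2 + v ^ 2 = 0 := by
    linear_combination coordC a * u * o1 - coordC a * coordA a * o2 - v ^ 2 * da
  obtain ⟨o4, o5⟩ := (add_eq_zero_iff_of_nonneg (sq_nonneg _) (sq_nonneg _)).1 o3
  have v0 : v = 0 := pow_eq_zero_iff two_ne_zero |>.1 o5
  have u0 : u = 0 := by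
    have : coordC a * u = 0 := by
      have := pow_eq_zero_iff two_ne_zero |>.1 o4
      rwa [v0, mul_zero, sub_zero] at this
    exact (mul_eq_zero.1 this).resolve_left hC.ne'
  have w0 : w = 0 := by
    rw [v0, u0] at o1
    have : w * coordA a = 0 := by linarith
    exact (mul_eq_zero.1 this).resolve_right (coordA_pos a).ne'
  exact ⟨l, k, hl0, hk0, by linarith, by linarith, by linarith⟩

theorem exists_coord_of_mem_triangle {a b c z : ℍ} (h : z ∈ triangle a b c) :
    ∃ α β γ : ℝ, 0 ≤ α ∧ 0 ≤ β ∧ 0 ≤ γ ∧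
      coordA z = α * coordA a + β * coordA b + γ * coordA c ∧
      coordB z = α * coordB a + β * coordB b + γ * coordB c ∧
      coordC z = α * coordC a + β * coordC b + γ * coordC c := by
  obtain ⟨x, hx, hz⟩ := h
  obtain ⟨l, k, hl, hk, hA, hB, hC⟩ := exists_coord_of_mem_segment hx
  obtain ⟨l', k', hl', hk', hA', hB', hC'⟩ := exists_coord_of_mem_segment hz
  refine ⟨l', k' * l, k' * k, hl', mul_nonneg hk' hl, mul_nonneg hk' hk, ?_, ?_, ?_⟩
  · rw [hA', hA]; ring
  · rw [hB', hB]; ring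
  · rw [hC', hC]; ring

/-- A nonzero nonnegative combination of two points is a positive multiple of a point. -/
theorem exists_normalized_coord (b c : ℍ) {β γ : ℝ} (hβ : 0 ≤ β) (hγ : 0 ≤ γ) (h : 0 < β + γ) :
    ∃ x : ℍ, ∃ δ : ℝ, 0 < δ ∧ δ ^ 2 = β ^ 2 + γ ^ 2 + 2 * β * γ * Real.cosh (dist b c) ∧
      δ * coordA x = β * coordA b + γ * coordA c ∧
      δ * coordB x = β * coordB b + γ * coordB c ∧
      δ * coordC x = β * coordC b + γ * coordC c := by
  have db := coord_det b
  have dc := coord_det c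
  have hd := cosh_dist_coord b c
  have hc1 := Real.one_le_cosh (dist b c)
  set D := β ^ 2 + γ ^ 2 + 2 * β * γ * Real.cosh (dist b c) with hD
  have hDpos : 0 < D := by
    have : 0 ≤ 2 * β * γ * (Real.cosh (dist b c) - 1) := mul_nonneg (by positivity) (by linarith)
    nlinarith
  have hs := Real.sq_sqrt hDpos.le
  have hs0 := Real.sqrt_pos.2 hDpos
  set δ := Real.sqrt D
  have hC : 0 < β * coordC b + γ * coordC c := by
    have := coordC_pos b
    have := coordC_pos c
    rcases hβ.eq_or_lt with rfl | hβ
    · have : 0 < γ := by linarith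
      positivity
    · positivity
  obtain ⟨x, hA, hB, hC⟩ := exists_coord (A := (β * coordA b + γ * coordA c) / δ)
    (B := (β * coordB b + γ * coordB c) / δ) (C := (β * coordC b + γ * coordC c) / δ)
    (div_pos hC hs0) (by
      field_simp
      rw [hs, hD, hd]
      linear_combination β ^ 2 * db + γ ^ 2 * dc)
  exact ⟨x, δ, hs0, hs, by rw [hA]; field_simp, by rw [hB]; field_simp, by rw [hC]; field_simp⟩

theorem mem_triangle_of_coord {a b c z : ℍ} {α β γ : ℝ} (hα : 0 ≤ α) (hβ : 0 ≤ β) (hγ : 0 ≤ γ)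
    (hA : coordA z = α * coordA a + β * coordA b + γ * coordA c)
    (hB : coordB z = α * coordB a + β * coordB b + γ * coordB c)
    (hC : coordC z = α * coordC a + β * coordC b + γ * coordC c) : z ∈ triangle a b c := by
  -- With `β = γ = 0` no point of the opposite side is singled out, and `b` serves.
  rcases (add_nonneg hβ hγ).eq_or_lt with h0 | h0
  · obtain rfl : β = 0 := by linarith
    obtain rfl : γ = 0 := by linarith
    refine ⟨b, by simp [segment], mem_segment_of_coord hα le_rfl ?_ ?_ ?_⟩ <;> linarith
  · obtain ⟨x, δ, hδ, -, h1, h2, h3⟩ := exists_normalized_coord b c hβ hγ h0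
    refine ⟨x, mem_segment_of_coord (l := β / δ) (k := γ / δ) (by positivity) (by positivity)
      ?_ ?_ ?_, mem_segment_of_coord hα hδ.le ?_ ?_ ?_⟩
    · field_simp; linarith
    · field_simp; linarith
    · field_simp; linarith
    · linarith
    · linarith
    · linarith

/-! ### The reflections in the sides of the triangle with angles `π / 4`, `π / 2`, `π / n` -/

theorem isometry_of_coord {f : ℍ → ℍ} (hA : ∀ z, coordA (f z) = coordA z)
    (hB : ∀ z, coordB (f z) = -coordB z) (hC : ∀ z, coordC (f z) = coordC z) : Isometry f := by
  refine Isometry.of_dist_eq fun z w => ?_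
  rw [← Real.arcosh_cosh (dist_nonneg (x := f z) (y := f w)),
    ← Real.arcosh_cosh (dist_nonneg (x := z) (y := w)), cosh_dist_coord, cosh_dist_coord,
    hA, hA, hB, hB, hC, hC]
  congr 1
  ring

/-- The reflection `z ↦ -conj z` in the imaginary axis. -/
noncomputable def mirror : ℍ ≃ᵢ ℍ where
  toFun z := ⟨⟨-z.re, z.im⟩, z.im_pos⟩
  invFun z := ⟨⟨-z.re, z.im⟩, z.im_pos⟩
  left_inv z := UpperHalfPlane.ext_re_im (neg_neg z.re) rfl
  right_inv z := UpperHalfPlane.ext_re_im (neg_neg z.re) rfl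
  isometry_toFun := by
    refine isometry_of_coord (fun z => ?_) (fun z => ?_) fun z => ?_
    · change ((-z.re) ^ 2 + z.im ^ 2) / z.im = _
      rw [neg_sq, coordA]
    · change -z.re / z.im = _
      rw [neg_div, coordB]
    · rfl

theorem coord_mirror (z : ℍ) : coordA (mirror z) = coordA z ∧ coordB (mirror z) = -coordB z ∧
    coordC (mirror z) = coordC z := by
  refine ⟨?_, ?_, rfl⟩
  · change ((-z.re) ^ 2 + z.im ^ 2) / z.im = _
    rw [neg_sq, coordA]
  · change -z.re / z.im = _
    rw [neg_div, coordB]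

theorem moebius_apply (g : Matrix.SpecialLinearGroup (Fin 2) ℝ) (z : ℍ) : moebius g z = g • z := rfl

/-- The reflections in the imaginary axis, in the geodesic through `i` at the angle `π / 4` to it,
and in the perpendicular bisector of `i` and `exp r * i`. -/
noncomputable def wallReflection (r : ℝ) : Fin 3 → ℍ ≃ᵢ ℍ :=
  ![mirror, moebius (rotMat (Real.pi / 4)) * mirror,
    mirror * (moebius (diagMat r) * (moebius (rotMat (Real.pi / 4)) * moebius (rotMat (Real.pi / 4))))]

/-- The linear forms that define the three walls. -/
noncomputable def wallForm (r : ℝ) : Fin 3 → ℝ → ℝ → ℝ → ℝ :=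
  ![fun _ B _ => B, fun A B C => (A - 2 * B - C) / (2 * Real.sqrt 2),
    fun A _ C => (Real.exp (r / 2) * C - Real.exp (-(r / 2)) * A) / 2]

/-- The signed side of a point with respect to the three walls. -/
noncomputable def wallSide (r : ℝ) (i : Fin 3) (z : ℍ) : ℝ :=
  wallForm r i (coordA z) (coordB z) (coordC z)

/-- The Coxeter matrix of the triangle group `(2, 4, n)`. -/
def triangleMatrix (n : ℕ) : Fin 3 → Fin 3 → ℕ := ![![1, 4, 2], ![4, 1, n], ![2, n, 1]]

theorem wallForm_add (r : ℝ) (i : Fin 3) (A B C A' B' C' : ℝ) :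
    wallForm r i (A + A') (B + B') (C + C') = wallForm r i A B C + wallForm r i A' B' C' := by
  fin_cases i <;> simp [wallForm] <;> ring

theorem wallForm_mul (r : ℝ) (i : Fin 3) (t A B C : ℝ) :
    wallForm r i (t * A) (t * B) (t * C) = t * wallForm r i A B C := by
  fin_cases i <;> simp [wallForm] <;> ring

/-- The forms give `B`, then `A - C`, then `C`, the last because `exp (r/2) ≠ exp (-(r/2))`. -/
theorem wallForm_separating {r : ℝ} (hr : 0 < r) {A B C A' B' C' : ℝ}
    (h : ∀ i, wallForm r i A B C = wallForm r i A' B' C') : A = A' ∧ B = B' ∧ C = C' := by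
  have h0 : B = B' := h 0
  have h1 : (A - 2 * B - C) / (2 * Real.sqrt 2) = (A' - 2 * B' - C') / (2 * Real.sqrt 2) := h 1
  have h2 : (Real.exp (r / 2) * C - Real.exp (-(r / 2)) * A) / 2 =
    (Real.exp (r / 2) * C' - Real.exp (-(r / 2)) * A') / 2 := h 2
  rw [div_left_inj' (by positivity)] at h1
  have h3 : A - C = A' - C' := by rw [h0] at h1; linarith
  have hlt : Real.exp (-(r / 2)) < Real.exp (r / 2) := Real.exp_lt_exp.2 (by linarith)
  have h4 : (Real.exp (r / 2) - Real.exp (-(r / 2))) * (C - C') = 0 := by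
    linear_combination 2 * h2 + Real.exp (-(r / 2)) * h3
  have h5 : C - C' = 0 := (mul_eq_zero.1 h4).resolve_left (by linarith)
  exact ⟨by linarith, h0, by linarith⟩

theorem wallSide_of_coord (r : ℝ) (i : Fin 3) {x y z : ℍ} {δ β γ : ℝ}
    (hA : δ * coordA x = β * coordA y + γ * coordA z)
    (hB : δ * coordB x = β * coordB y + γ * coordB z)
    (hC : δ * coordC x = β * coordC y + γ * coordC z) :
    δ * wallSide r i x = β * wallSide r i y + γ * wallSide r i z := by
  simp only [wallSide]
  rw [← wallForm_mul, hA, hB, hC, wallForm_add, wallForm_mul, wallForm_mul]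

theorem continuous_wallSide (r : ℝ) (i : Fin 3) : Continuous (wallSide r i) := by
  fin_cases i
  · exact continuous_coordB
  · exact ((continuous_coordA.sub (continuous_coordB.const_mul 2)).sub
      continuous_coordC).div_const _
  · exact ((continuous_coordC.const_mul _).sub (continuous_coordA.const_mul _)).div_const _

theorem coord_wallReflection_one (r : ℝ) (z : ℍ) :
    coordA (wallReflection r 1 z) = (coordA z + 2 * coordB z + coordC z) / 2 ∧
    coordB (wallReflection r 1 z) = (coordA z - coordC z) / 2 ∧
    coordC (wallReflection r 1 z) = (coordA z - 2 * coordB z + coordC z) / 2 := by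
  change coordA (rotMat (Real.pi / 4) • mirror z) = _ ∧
    coordB (rotMat (Real.pi / 4) • mirror z) = _ ∧ coordC (rotMat (Real.pi / 4) • mirror z) = _
  obtain ⟨h1, h2, h3⟩ := coord_quarterTurn (mirror z)
  obtain ⟨k1, k2, k3⟩ := coord_mirror z
  rw [h1, h2, h3, k1, k2, k3]
  refine ⟨?_, ?_, ?_⟩ <;> ring

/-- The half-turn about `i` swaps the diagonal entries and negates the other, the translation scales
the diagonal, and the mirror restores the sign. The composite is `z ↦ exp r / conj z`. -/
theorem coord_wallReflection_two (r : ℝ) (z : ℍ) :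
    coordA (wallReflection r 2 z) = Real.exp r * coordC z ∧
    coordB (wallReflection r 2 z) = coordB z ∧
    coordC (wallReflection r 2 z) = Real.exp (-r) * coordA z := by
  set y := rotMat (Real.pi / 4) • rotMat (Real.pi / 4) • z with hy
  change coordA (mirror (diagMat r • y)) = _ ∧ coordB (mirror (diagMat r • y)) = _ ∧
    coordC (mirror (diagMat r • y)) = _
  obtain ⟨k1, k2, k3⟩ := coord_mirror (diagMat r • y)
  obtain ⟨d1, d2, d3⟩ := coord_diagMat r y
  obtain ⟨h1, h2, h3⟩ := coord_quarterTurn (rotMat (Real.pi / 4) • z)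
  obtain ⟨l1, l2, l3⟩ := coord_quarterTurn z
  rw [k1, k2, k3, d1, d2, d3, hy, h1, h2, h3, l1, l2, l3]
  refine ⟨?_, ?_, ?_⟩ <;> ring

theorem exp_half_mul (r : ℝ) : Real.exp (r / 2) * Real.exp (-(r / 2)) = 1 ∧
    Real.exp r = Real.exp (r / 2) ^ 2 ∧ Real.exp (-r) = Real.exp (-(r / 2)) ^ 2 := by
  refine ⟨by rw [← Real.exp_add]; simp, ?_, ?_⟩ <;>
  · rw [← Real.exp_nat_mul]; congr 1; push_cast; ring

/-- The reflections satisfy the relations of the triangle group `(2, 4, n)`. -/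
theorem reflectionSystem {n : ℕ} (hn : 2 ≤ n) {r : ℝ} (hr : 0 < r)
    (hrn : Real.cosh (r / 2) = Real.sqrt 2 * Real.cos (Real.pi / n)) :
    ReflectionSystem (wallReflection r) (wallSide r) (triangleMatrix n) where
  m_symm i j := by fin_cases i <;> fin_cases j <;> rfl
  two_le_m i j hij := by
    fin_cases i <;> fin_cases j <;> first | exact absurd rfl hij | simp [triangleMatrix, hn]
  apply_self i z := by
    fin_cases i
    · exact (coord_mirror z).2.1
    · obtain ⟨h1, h2, h3⟩ := coord_wallReflection_one r z
      change (coordA (wallReflection r 1 z) - 2 * coordB (wallReflection r 1 z)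
        - coordC (wallReflection r 1 z)) / (2 * Real.sqrt 2) =
        -((coordA z - 2 * coordB z - coordC z) / (2 * Real.sqrt 2))
      rw [h1, h2, h3]
      ring
    · obtain ⟨h1, h2, h3⟩ := coord_wallReflection_two r z
      obtain ⟨e1, e2, e3⟩ := exp_half_mul r
      change (Real.exp (r / 2) * coordC (wallReflection r 2 z) -
        Real.exp (-(r / 2)) * coordA (wallReflection r 2 z)) / 2 =
        -((Real.exp (r / 2) * coordC z - Real.exp (-(r / 2)) * coordA z) / 2)
      rw [h1, h3, e2, e3]
      linear_combination (Real.exp (-(r / 2)) * coordA z - Real.exp (r / 2) * coordC z) / 2 * e1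
  apply_of_ne i j hij z := by
    have hs := Real.sq_sqrt (show (0 : ℝ) ≤ 2 by norm_num)
    have hs0 : Real.sqrt 2 ≠ 0 := by positivity
    obtain ⟨a1, a2, a3⟩ : coordA (wallReflection r 0 z) = coordA z ∧
      coordB (wallReflection r 0 z) = -coordB z ∧ coordC (wallReflection r 0 z) = coordC z :=
      coord_mirror z
    obtain ⟨b1, b2, b3⟩ := coord_wallReflection_one r z
    obtain ⟨c1, c2, c3⟩ := coord_wallReflection_two r z
    obtain ⟨e1, e2, e3⟩ := exp_half_mul r
    rw [Real.cosh_eq] at hrn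
    have w0 : ∀ y, wallSide r 0 y = coordB y := fun _ => rfl
    have w1 : ∀ y, wallSide r 1 y = (coordA y - 2 * coordB y - coordC y) / (2 * Real.sqrt 2) :=
      fun _ => rfl
    have w2 : ∀ y, wallSide r 2 y =
      (Real.exp (r / 2) * coordC y - Real.exp (-(r / 2)) * coordA y) / 2 := fun _ => rfl
    -- The value of `r` enters here: it makes `π / n` the angle between walls `1` and `2`. The other
    -- two angles do not depend on `r`.
    have hn' : Real.cos (Real.pi / n) = (Real.exp (r / 2) + Real.exp (-(r / 2))) /
        (2 * Real.sqrt 2) := by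
      field_simp
      linarith
    fin_cases i <;> fin_cases j <;> try exact absurd rfl hij
    · change wallSide r 1 (wallReflection r 0 z) =
        wallSide r 1 z + 2 * Real.cos (Real.pi / (4 : ℕ)) * wallSide r 0 z
      rw [w1, w1, w0, a1, a2, a3]
      push_cast
      rw [Real.cos_pi_div_four]
      field_simp
      linear_combination (-2) * coordB z * hs
    · change wallSide r 2 (wallReflection r 0 z) =
        wallSide r 2 z + 2 * Real.cos (Real.pi / (2 : ℕ)) * wallSide r 0 z
      rw [w2, w2, a1, a3]
      push_cast
      rw [Real.cos_pi_div_two]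
      ring
    · change wallSide r 0 (wallReflection r 1 z) =
        wallSide r 0 z + 2 * Real.cos (Real.pi / (4 : ℕ)) * wallSide r 1 z
      rw [w0, w0, w1, b2]
      push_cast
      rw [Real.cos_pi_div_four]
      field_simp
      ring
    · change wallSide r 2 (wallReflection r 1 z) =
        wallSide r 2 z + 2 * Real.cos (Real.pi / n) * wallSide r 1 z
      rw [w2, w2, w1, b1, b3, hn']
      field_simp
      rw [hs]
      ring
    · change wallSide r 0 (wallReflection r 2 z) =
        wallSide r 0 z + 2 * Real.cos (Real.pi / (2 : ℕ)) * wallSide r 2 z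
      rw [w0, w0, c2]
      push_cast
      rw [Real.cos_pi_div_two]
      ring
    · change wallSide r 1 (wallReflection r 2 z) =
        wallSide r 1 z + 2 * Real.cos (Real.pi / n) * wallSide r 2 z
      rw [w1, w1, w2, c1, c2, c3, hn', e2, e3]
      field_simp
      linear_combination (coordA z - coordC z) * e1
  separating z w h := by
    obtain ⟨-, h2, h3⟩ := wallForm_separating hr h
    exact ext_coord h2 h3

/-- The wall forms are pairings with unit normals, and a reflection moves `z` by a multiple of the
normal. If `z` and `x` are on opposite sides, the added term is negative. -/
theorem cosh_dist_wallReflection (r : ℝ) (i : Fin 3) (z x : ℍ) :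
    Real.cosh (dist (wallReflection r i z) x) =
      Real.cosh (dist z x) + 2 * wallSide r i z * wallSide r i x := by
  rw [cosh_dist_coord, cosh_dist_coord]
  fin_cases i
  · obtain ⟨a1, a2, a3⟩ : coordA (wallReflection r 0 z) = coordA z ∧
      coordB (wallReflection r 0 z) = -coordB z ∧ coordC (wallReflection r 0 z) = coordC z :=
      coord_mirror z
    have w0 : ∀ y, wallSide r 0 y = coordB y := fun _ => rfl
    change (coordA (wallReflection r 0 z) * coordC x + coordC (wallReflection r 0 z) * coordA x -
      2 * coordB (wallReflection r 0 z) * coordB x) / 2 = _ + 2 * wallSide r 0 z * wallSide r 0 x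
    rw [a1, a2, a3, w0, w0]
    ring
  · obtain ⟨a1, a2, a3⟩ := coord_wallReflection_one r z
    have w1 : ∀ y, wallSide r 1 y = (coordA y - 2 * coordB y - coordC y) / (2 * Real.sqrt 2) :=
      fun _ => rfl
    change (coordA (wallReflection r 1 z) * coordC x + coordC (wallReflection r 1 z) * coordA x -
      2 * coordB (wallReflection r 1 z) * coordB x) / 2 = _ + 2 * wallSide r 1 z * wallSide r 1 x
    have hs := Real.sq_sqrt (show (0 : ℝ) ≤ 2 by norm_num)
    rw [a1, a2, a3, w1, w1]
    field_simp
    rw [hs]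
    ring
  · obtain ⟨a1, a2, a3⟩ := coord_wallReflection_two r z
    obtain ⟨e1, e2, e3⟩ := exp_half_mul r
    have w2 : ∀ y, wallSide r 2 y =
      (Real.exp (r / 2) * coordC y - Real.exp (-(r / 2)) * coordA y) / 2 := fun _ => rfl
    change (coordA (wallReflection r 2 z) * coordC x + coordC (wallReflection r 2 z) * coordA x -
      2 * coordB (wallReflection r 2 z) * coordB x) / 2 = _ + 2 * wallSide r 2 z * wallSide r 2 x
    rw [a1, a2, a3, w2, w2, e2, e3]
    linear_combination (coordC z * coordA x + coordA z * coordC x) / 2 * e1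

theorem dist_wallReflection_lt {r : ℝ} {i : Fin 3} {z x : ℍ} (hz : wallSide r i z < 0)
    (hx : 0 < wallSide r i x) : dist (wallReflection r i z) x < dist z x := by
  have h := cosh_dist_wallReflection r i z x
  have h1 : wallSide r i z * wallSide r i x < 0 := mul_neg_of_neg_of_pos hz hx
  have h2 : Real.cosh (dist (wallReflection r i z) x) < Real.cosh (dist z x) := by linarith
  rwa [Real.cosh_lt_cosh, abs_of_nonneg dist_nonneg, abs_of_nonneg dist_nonneg] at h2

theorem exists_chamber_point {r : ℝ} (hr : 0 < r) : ∃ x : ℍ, ∀ i, 0 < wallSide r i x := by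
  -- The point is pushed off the imaginary axis from `exp (r/4) * i`, which lies halfway between the
  -- chamber vertices `i` and `exp (r/2) * i`. Wall `1` requires `2 B < A - C`; the choice of `B`
  -- leaves a factor of two, and `S` restores determinant one.
  set e := Real.exp (r / 4) with he
  have he1 : 1 < e := Real.one_lt_exp_iff.2 (by positivity)
  have e1 : Real.exp (r / 2) = e ^ 2 := by
    rw [he, ← Real.exp_nat_mul]; congr 1; push_cast; ring
  have e2 : Real.exp (-(r / 2)) = (e ^ 2)⁻¹ := by rw [Real.exp_neg, e1]
  have hpos : 0 < e - 1 / e := by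
    rw [sub_pos, div_lt_iff₀ (by positivity)]
    nlinarith
  set B := (e - 1 / e) / 4 with hB
  set S := Real.sqrt (1 + B ^ 2) with hS
  have hS2 : S ^ 2 = 1 + B ^ 2 := Real.sq_sqrt (by positivity)
  have hS1 : 1 ≤ S := by rw [hS]; exact Real.one_le_sqrt.2 (by nlinarith [sq_nonneg B])
  obtain ⟨x, hx1, hx2, hx3⟩ := exists_coord (A := e * S) (B := B) (C := S / e) (by positivity)
    (by field_simp; linarith)
  refine ⟨x, fun i => ?_⟩
  have h1 : e * S - S / e = S * (e - 1 / e) := by field_simp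
  fin_cases i
  · change 0 < coordB x
    rw [hx2]
    positivity
  · change 0 < (coordA x - 2 * coordB x - coordC x) / (2 * Real.sqrt 2)
    rw [hx1, hx2, hx3]
    refine div_pos ?_ (by positivity)
    have h2 : e - 1 / e ≤ S * (e - 1 / e) := le_mul_of_one_le_left hpos.le hS1
    linarith
  · change 0 < (Real.exp (r / 2) * coordC x - Real.exp (-(r / 2)) * coordA x) / 2
    rw [hx1, hx3, e1, e2]
    have h2 : e ^ 2 * (S / e) - (e ^ 2)⁻¹ * (e * S) = S * (e - 1 / e) := by field_simp
    rw [h2]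
    positivity

/-- The open chamber is dense in the closed chamber. -/
theorem exists_chamber_point_mem {r : ℝ} (hr : 0 < r) {z : ℍ} (hz : ∀ i, 0 ≤ wallSide r i z)
    {U : Set ℍ} (hU : IsOpen U) (hzU : z ∈ U) : ∃ y ∈ U, ∀ i, 0 < wallSide r i y := by
  obtain ⟨x, hx⟩ := exists_chamber_point hr
  obtain ⟨ε, hε, hball⟩ := Metric.isOpen_iff.1 hU z hzU
  set d := Real.cosh (dist z x) with hd
  have hd1 : 1 ≤ d := Real.one_le_cosh _
  have hε1 : 1 < Real.cosh ε := Real.one_lt_cosh.2 hε.ne'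
  -- The new point is `z + t x`, normalized by `δ ≥ 1`. This `t` gives `δ * cosh (dist y z) = 1 + t
  -- d = (1 + cosh ε) / 2 < cosh ε`.
  set t := (Real.cosh ε - 1) / (2 * d) with ht
  have ht0 : 0 < t := div_pos (by linarith) (by positivity)
  obtain ⟨y, δ, hδ, hδ2, hA, hB, hC⟩ :=
    exists_normalized_coord z x zero_le_one ht0.le (by linarith)
  have hδ1 : 1 ≤ δ := by
    rw [← one_le_sq_iff₀ hδ.le, hδ2]
    have : 0 ≤ t * d := by positivity
    nlinarith [sq_nonneg t]
  refine ⟨y, hball ?_, fun i => ?_⟩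
  · rw [Metric.mem_ball, ← abs_of_nonneg (dist_nonneg (x := y) (y := z)), ← abs_of_pos hε,
      ← Real.cosh_lt_cosh]
    have h1 : δ * Real.cosh (dist y z) = 1 + t * d := by
      rw [cosh_dist_coord, hd, cosh_dist_coord]
      have := coord_det z
      linear_combination coordC z / 2 * hA + coordA z / 2 * hC - coordB z * hB + this
    have h2 : t * d = (Real.cosh ε - 1) / 2 := by rw [ht]; field_simp
    have h3 : Real.cosh (dist y z) ≤ δ * Real.cosh (dist y z) :=
      le_mul_of_one_le_left (Real.cosh_pos _).le hδ1
    linarith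
  · have h1 := wallSide_of_coord r i hA hB hC
    have h2 : 0 < t * wallSide r i x := mul_pos ht0 (hx i)
    refine pos_of_mul_pos_right (a := δ) ?_ hδ.le
    linarith [hz i]

/-! ### The rotation subgroup and its fundamental triangle -/

/-- The group `G_r` for the base point `i` and the upward direction. -/
noncomputable def baseGroup (r : ℝ) : Subgroup (ℍ ≃ᵢ ℍ) :=
  Subgroup.closure {moebius (rotMat (Real.pi / 4)), moebius (diagMat r)}

/-- The fundamental triangle for the base point `i` and the upward direction. -/
def baseTriangle (r : ℝ) : Set ℍ :=
  {z | 0 ≤ wallSide r 0 z ∧ 0 ≤ wallSide r 1 z ∧ 0 ≤ wallSide r 1 (wallReflection r 2 z)}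

theorem mirror_mul_self : mirror * mirror = 1 :=
  IsometryEquiv.ext fun z => mirror.symm_apply_apply z

theorem rot_eq (r : ℝ) :
    moebius (rotMat (Real.pi / 4)) = wallReflection r 1 * wallReflection r 0 := by
  change _ = moebius (rotMat (Real.pi / 4)) * mirror * mirror
  rw [mul_assoc, mirror_mul_self, mul_one]

/-- The left side is the half-turn about the midpoint of `i` and `exp r * i`, where walls `0` and
`2` cross at a right angle. -/
theorem diag_mul_rot_eq (r : ℝ) :
    moebius (diagMat r) * (moebius (rotMat (Real.pi / 4)) * moebius (rotMat (Real.pi / 4))) =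
      wallReflection r 0 * wallReflection r 2 := by
  change _ = mirror * (mirror * _)
  rw [← mul_assoc mirror, mirror_mul_self, one_mul]

theorem rot_mem (r : ℝ) : moebius (rotMat (Real.pi / 4)) ∈ baseGroup r :=
  Subgroup.subset_closure (Set.mem_insert _ _)

theorem diag_mem (r : ℝ) : moebius (diagMat r) ∈ baseGroup r :=
  Subgroup.subset_closure (Set.mem_insert_of_mem _ rfl)

theorem baseGroup_le (r : ℝ) : baseGroup r ≤ Subgroup.closure (Set.range (wallReflection r)) := by
  have hs : ∀ i, wallReflection r i ∈ Subgroup.closure (Set.range (wallReflection r)) :=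
    fun i => Subgroup.subset_closure ⟨i, rfl⟩
  have h1 : moebius (rotMat (Real.pi / 4)) ∈ Subgroup.closure (Set.range (wallReflection r)) := by
    rw [rot_eq r]
    exact mul_mem (hs 1) (hs 0)
  refine (Subgroup.closure_le _).2 ?_
  rintro _ (rfl | rfl)
  · exact h1
  · have h2 := diag_mul_rot_eq r
    rw [← eq_mul_inv_iff_mul_eq] at h2
    rw [h2]
    exact mul_mem (mul_mem (hs 0) (hs 2)) (inv_mem (mul_mem h1 h1))

theorem baseGroup_le_range (r : ℝ) : baseGroup r ≤ moebius.range := by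
  refine (Subgroup.closure_le _).2 ?_
  rintro _ (rfl | rfl) <;> exact ⟨_, rfl⟩

theorem wallReflection_mul_mem {n : ℕ} {r : ℝ}
    (h : ReflectionSystem (wallReflection r) (wallSide r) (triangleMatrix n)) (i : Fin 3) :
    wallReflection r i * wallReflection r 2 ∈ baseGroup r := by
  have h0 : wallReflection r 0 * wallReflection r 2 ∈ baseGroup r := by
    rw [← diag_mul_rot_eq]
    exact mul_mem (diag_mem r) (mul_mem (rot_mem r) (rot_mem r))
  fin_cases i
  · exact h0
  · have h1 : wallReflection r 1 * wallReflection r 2 =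
        (wallReflection r 1 * wallReflection r 0) * (wallReflection r 0 * wallReflection r 2) := by
      rw [mul_assoc, h.mul_mul_self]
    change wallReflection r 1 * wallReflection r 2 ∈ baseGroup r
    rw [h1, ← rot_eq]
    exact mul_mem (rot_mem r) h0
  · change wallReflection r 2 * wallReflection r 2 ∈ baseGroup r
    rw [h.mul_self]
    exact one_mem _

/-- The rotation subgroup has index two in the reflection group. -/
theorem mem_or_mul_mem_baseGroup {n : ℕ} {r : ℝ}
    (h : ReflectionSystem (wallReflection r) (wallSide r) (triangleMatrix n)) {w : ℍ ≃ᵢ ℍ}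
    (hw : w ∈ Subgroup.closure (Set.range (wallReflection r))) :
    w ∈ baseGroup r ∨ w * wallReflection r 2 ∈ baseGroup r := by
  have hinv : ∀ i, (wallReflection r i)⁻¹ = wallReflection r i :=
    fun i => inv_eq_of_mul_eq_one_left (h.mul_self i)
  have step : ∀ w i, (w ∈ baseGroup r ∨ w * wallReflection r 2 ∈ baseGroup r) →
      (w * wallReflection r i ∈ baseGroup r ∨
        w * wallReflection r i * wallReflection r 2 ∈ baseGroup r) := by
    rintro w i (hw | hw)
    · right
      rw [mul_assoc]
      exact mul_mem hw (wallReflection_mul_mem h i)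
    · left
      have := mul_mem hw (inv_mem (wallReflection_mul_mem h i))
      rwa [mul_inv_rev, hinv, hinv, mul_assoc, h.mul_mul_self] at this
  induction hw using Subgroup.closure_induction_right with
  | one => exact Or.inl (one_mem _)
  | mul_right x _ y hy ih =>
    obtain ⟨i, rfl⟩ := hy
    exact step x i ih
  | mul_inv_cancel x _ y hy ih =>
    obtain ⟨i, rfl⟩ := hy
    rw [hinv]
    exact step x i ih

/-- The reflection `z ↦ -conj z` reverses the orientation. -/
theorem mirror_notMem_range : mirror ∉ moebius.range := by
  rintro ⟨g, hg⟩
  have key : ∀ z : ℍ, coordB z = 0 → coordC (g • z) = coordC z ∧ coordB (g • z) = 0 := by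
    intro z hz
    rw [← moebius_apply, hg, (coord_mirror z).2.1, (coord_mirror z).2.2, hz]
    simp
  have hd : g 0 0 * g 1 1 - g 0 1 * g 1 0 = 1 := by
    have := g.2
    rwa [Matrix.det_fin_two] at this
  -- The test points are `1 + i`, `i / 2` and `i`. The last two force `g 1 0 = 0` and `g 0 1 * g 1 1
  -- = 0`; then determinant one gives `coordB = 1` at the image of `1 + i`, where the mirror gives
  -- `-1`.
  obtain ⟨z, hA, hB, hC⟩ := exists_coord (A := 2) (B := 1) (C := 1) one_pos (by norm_num)
  obtain ⟨y, yA, yB, yC⟩ := exists_coord (A := 1 / 2) (B := 0) (C := 2) two_pos (by norm_num)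
  obtain ⟨i1, i2, i3⟩ := coord_I
  obtain ⟨a1, a2⟩ := key UpperHalfPlane.I i2
  obtain ⟨b1, b2⟩ := key y yB
  have c1 : coordB (g • z) = -1 := by rw [← moebius_apply, hg, (coord_mirror z).2.1, hB]
  rw [(coord_smul g _).2.2, i1, i2, i3] at a1
  rw [(coord_smul g _).2.1, i1, i2, i3] at a2
  rw [(coord_smul g _).2.2, yA, yB, yC] at b1
  rw [(coord_smul g _).2.1, hA, hB, hC] at c1
  have h10 : g 1 0 ^ 2 = 0 := by linarith
  have h10 : g 1 0 = 0 := pow_eq_zero_iff two_ne_zero |>.1 h10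
  rw [h10] at a1 a2 c1 hd
  have h11 : g 0 1 * g 1 1 = 0 := by linarith
  linarith

/-- Otherwise the product with `wallReflection r 0 * wallReflection r 2` would put the mirror in the
group. This is what keeps the two halves of the triangle inequivalent. -/
theorem wallReflection_two_notMem {n : ℕ} {r : ℝ}
    (h : ReflectionSystem (wallReflection r) (wallSide r) (triangleMatrix n)) :
    wallReflection r 2 ∉ baseGroup r := by
  intro h2
  have h1 := mul_mem (wallReflection_mul_mem h 0) h2
  rw [mul_assoc, h.mul_self, mul_one] at h1
  exact mirror_notMem_range (baseGroup_le_range r h1)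

theorem wallSide_one_reflection_two {n : ℕ} {r : ℝ}
    (h : ReflectionSystem (wallReflection r) (wallSide r) (triangleMatrix n)) (z : ℍ) :
    wallSide r 1 (wallReflection r 2 z) =
      wallSide r 1 z + 2 * Real.cos (Real.pi / n) * wallSide r 2 z :=
  h.apply_of_ne 2 1 (by decide) z

theorem wallSide_zero_reflection_two {n : ℕ} {r : ℝ}
    (h : ReflectionSystem (wallReflection r) (wallSide r) (triangleMatrix n)) (z : ℍ) :
    wallSide r 0 (wallReflection r 2 z) = wallSide r 0 z := by
  have := h.apply_of_ne 2 0 (by decide) z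
  change _ = _ + 2 * Real.cos (Real.pi / (2 : ℕ)) * _ at this
  push_cast at this
  rwa [Real.cos_pi_div_two, mul_zero, zero_mul, add_zero] at this

theorem reflection_two_reflection_two {n : ℕ} {r : ℝ}
    (h : ReflectionSystem (wallReflection r) (wallSide r) (triangleMatrix n)) (z : ℍ) :
    wallReflection r 2 (wallReflection r 2 z) = z := by
  rw [← IsometryEquiv.mul_apply, h.mul_self, IsometryEquiv.coe_one, id]

/-- The triangle is the double of the closed chamber. -/
theorem mem_baseTriangle_iff {n : ℕ} (hn : 2 ≤ n) {r : ℝ}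
    (h : ReflectionSystem (wallReflection r) (wallSide r) (triangleMatrix n)) (z : ℍ) :
    z ∈ baseTriangle r ↔ (∀ i, 0 ≤ wallSide r i z) ∨
      ∀ i, 0 ≤ wallSide r i (wallReflection r 2 z) := by
  -- Since walls `1` and `2` do not meet at an obtuse angle, nonnegativity on both implies the third
  -- condition of `baseTriangle`.
  have hcos : 0 ≤ Real.cos (Real.pi / n) := by
    have h2 : (2 : ℝ) ≤ n := by exact_mod_cast hn
    have : Real.pi / n ≤ Real.pi / 2 := div_le_div_of_nonneg_left Real.pi_pos.le two_pos h2
    exact Real.cos_nonneg_of_neg_pi_div_two_le_of_le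
      (by linarith [Real.pi_pos, div_nonneg Real.pi_pos.le (n.cast_nonneg (α := ℝ))]) this
  have h0 := wallSide_zero_reflection_two h z
  have h1 := wallSide_one_reflection_two h z
  have h2 : wallSide r 2 (wallReflection r 2 z) = -wallSide r 2 z := h.apply_self 2 z
  have h1' := wallSide_one_reflection_two h (wallReflection r 2 z)
  rw [reflection_two_reflection_two h] at h1'
  simp only [Fin.forall_fin_succ, Fin.forall_fin_zero]
  change 0 ≤ wallSide r 0 z ∧ 0 ≤ wallSide r 1 z ∧ 0 ≤ wallSide r 1 (wallReflection r 2 z) ↔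
    (0 ≤ wallSide r 0 z ∧ 0 ≤ wallSide r 1 z ∧ 0 ≤ wallSide r 2 z ∧ True) ∨
    (0 ≤ wallSide r 0 (wallReflection r 2 z) ∧ 0 ≤ wallSide r 1 (wallReflection r 2 z) ∧
      0 ≤ wallSide r 2 (wallReflection r 2 z) ∧ True)
  constructor
  · rintro ⟨a0, a1, a2⟩
    rcases le_total 0 (wallSide r 2 z) with hz | hz
    · exact Or.inl ⟨a0, a1, hz, trivial⟩
    · exact Or.inr ⟨by rwa [h0], a2, by rw [h2]; linarith, trivial⟩
  · rintro (⟨a0, a1, a2, -⟩ | ⟨a0, a1, a2, -⟩)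
    · exact ⟨a0, a1, by rw [h1]; positivity⟩
    · exact ⟨by rwa [h0] at a0, by rw [h1']; positivity, a1⟩

/-! ### Covering and disjointness for the doubled chamber -/

theorem baseTriangle_cover {n : ℕ} (hn : 2 ≤ n) {r : ℝ} (hr : 0 < r)
    (h : ReflectionSystem (wallReflection r) (wallSide r) (triangleMatrix n)) (z : ℍ) :
    ∃ g ∈ baseGroup r, ∃ y ∈ baseTriangle r, g y = z := by
  obtain ⟨x, hx⟩ := exists_chamber_point hr
  obtain ⟨w, hw, hwz⟩ := h.exists_mem_closed_chamber (continuous_wallSide r) hx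
    (fun i y hy => dist_wallReflection_lt hy (hx i)) z
  rcases mem_or_mul_mem_baseGroup h (inv_mem hw) with hg | hg
  · exact ⟨w⁻¹, hg, w z, (mem_baseTriangle_iff hn h _).2 (Or.inl hwz),
      IsometryEquiv.inv_apply_self w z⟩
  · refine ⟨w⁻¹ * wallReflection r 2, hg, wallReflection r 2 (w z),
      (mem_baseTriangle_iff hn h _).2 (Or.inr ?_), ?_⟩
    · rwa [reflection_two_reflection_two h]
    · rw [IsometryEquiv.mul_apply, reflection_two_reflection_two h, IsometryEquiv.inv_apply_self]

/-- Write `z = k d` with `d` in the closed chamber and `k` either `1` or `c`. Two perturbations by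
density, the first within the interior of the triangle, lead to open chambers that meet, so `g k` is
again `1` or `c`. As `c` is not in the rotation group, `g = 1`. -/
theorem baseTriangle_disjoint {n : ℕ} (hn : 2 ≤ n) {r : ℝ} (hr : 0 < r)
    (h : ReflectionSystem (wallReflection r) (wallSide r) (triangleMatrix n)) {g : ℍ ≃ᵢ ℍ}
    (hg : g ∈ baseGroup r) {z : ℍ} (hz : z ∈ baseTriangle r)
    (hgz : g z ∈ interior (baseTriangle r)) : g = 1 := by
  set c := wallReflection r 2 with hc
  set W := Subgroup.closure (Set.range (wallReflection r)) with hW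
  have hcW : c ∈ W := Subgroup.subset_closure ⟨2, rfl⟩
  have hcc : c * c = 1 := h.mul_self 2
  have split : ∀ y ∈ baseTriangle r, ∃ k, (k = 1 ∨ k = c) ∧ ∃ d, (∀ i, 0 ≤ wallSide r i d) ∧
      k d = y := by
    intro y hy
    rcases (mem_baseTriangle_iff hn h y).1 hy with h1 | h1
    · exact ⟨1, Or.inl rfl, y, h1, rfl⟩
    · exact ⟨c, Or.inr rfl, c y, h1, reflection_two_reflection_two h y⟩
  have kW : ∀ k, k = 1 ∨ k = c → k ∈ W := by
    rintro k (rfl | rfl)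
    · exact one_mem _
    · exact hcW
  have hopen : IsOpen {y | ∀ i, 0 < wallSide r i y} := by
    rw [Set.ofPred_forall]
    exact isOpen_iInter_of_finite fun i => isOpen_lt continuous_const (continuous_wallSide r i)
  obtain ⟨k, hk, d, hd, rfl⟩ := split z hz
  obtain ⟨y, hyU, hy⟩ := exists_chamber_point_mem hr hd
    (isOpen_interior.preimage ((g * k).continuous)) hgz
  obtain ⟨k', hk', d', hd', hk'd'⟩ := split _ (interior_subset hyU)
  obtain ⟨x, hxU, hx⟩ := exists_chamber_point_mem hr hd'
    (hopen.preimage ((g * k)⁻¹ * k').continuous) (by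
      change ∀ i, 0 < wallSide r i ((g * k)⁻¹ (k' d'))
      rwa [hk'd', IsometryEquiv.inv_apply_self])
  have heq : (g * k)⁻¹ * k' = 1 :=
    h.eq_one_of_chamber (mul_mem (inv_mem (mul_mem (baseGroup_le r hg) (kW k hk))) (kW k' hk'))
      hx hxU
  have hgk : g * k = k' := inv_mul_eq_one.1 heq
  have hcG := wallReflection_two_notMem h
  rw [← hc] at hcG
  rcases hk with rfl | rfl <;> rcases hk' with rfl | rfl
  · rwa [mul_one] at hgk
  · rw [mul_one] at hgk
    exact absurd (hgk ▸ hg) hcG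
  · rw [mul_eq_one_iff_eq_inv, inv_eq_of_mul_eq_one_left hcc] at hgk
    exact absurd (hgk ▸ hg) hcG
  · exact mul_eq_right.1 hgk

/-- The triangle with vertices `i`, `exp r * i` and `s` is the fundamental triangle, for the third
vertex `s` of the chamber. -/
theorem triangle_eq_baseTriangle {n : ℕ} {r : ℝ} (hr : 0 < r)
    (hcos : 0 < Real.cos (Real.pi / n))
    (hrn : Real.cosh (r / 2) = Real.sqrt 2 * Real.cos (Real.pi / n))
    (h : ReflectionSystem (wallReflection r) (wallSide r) (triangleMatrix n)) {s : ℍ}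
    (h0 : 0 < wallSide r 0 s) (h1 : wallSide r 1 s = 0) (h2 : wallSide r 2 s = 0) :
    triangle UpperHalfPlane.I (diagMat r • UpperHalfPlane.I) s = baseTriangle r := by
  obtain ⟨i1, i2, i3⟩ := coord_I
  obtain ⟨d1, d2, d3⟩ := coord_diagMat r UpperHalfPlane.I
  obtain ⟨e1, e2, e3⟩ := exp_half_mul r
  rw [i1, mul_one] at d1
  rw [i2] at d2
  rw [i3, mul_one] at d3
  set q := diagMat r • UpperHalfPlane.I
  have w0 : ∀ y, wallSide r 0 y = coordB y := fun _ => rfl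
  have w1 : ∀ y, wallSide r 1 y = (coordA y - 2 * coordB y - coordC y) / (2 * Real.sqrt 2) :=
    fun _ => rfl
  have w2 : ∀ y, wallSide r 2 y =
    (Real.exp (r / 2) * coordC y - Real.exp (-(r / 2)) * coordA y) / 2 := fun _ => rfl
  have hlt : Real.exp (-(r / 2)) < Real.exp (r / 2) := Real.exp_lt_exp.2 (by linarith)
  have I0 : wallSide r 0 UpperHalfPlane.I = 0 := by rw [w0, i2]
  have I1 : wallSide r 1 UpperHalfPlane.I = 0 := by rw [w1, i1, i2, i3]; simp
  have I2 : 0 < wallSide r 2 UpperHalfPlane.I := by rw [w2, i1, i3]; linarith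
  have q0 : wallSide r 0 q = 0 := by rw [w0, d2]
  have q2 : wallSide r 2 q = -wallSide r 2 UpperHalfPlane.I := by
    rw [w2, w2, d1, d3, i1, i3, e2, e3]
    linear_combination (Real.exp (-(r / 2)) - Real.exp (r / 2)) / 2 * e1
  have q1 : wallSide r 1 q = 2 * Real.cos (Real.pi / n) * wallSide r 2 UpperHalfPlane.I := by
    have hn' : Real.cos (Real.pi / n) = (Real.exp (r / 2) + Real.exp (-(r / 2))) /
        (2 * Real.sqrt 2) := by
      rw [Real.cosh_eq] at hrn
      field_simp
      linarith
    rw [w1, w2, d1, d2, d3, i1, i3, hn', e2, e3]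
    field_simp
    ring
  set x := wallSide r 2 UpperHalfPlane.I
  ext z
  constructor
  · intro hz
    obtain ⟨α, β, γ, hα, hβ, hγ, hA, hB, hC⟩ := exists_coord_of_mem_triangle hz
    have hside : ∀ i, wallSide r i z = α * wallSide r i UpperHalfPlane.I + β * wallSide r i q
        + γ * wallSide r i s := fun i => by
      rw [wallSide, hA, hB, hC, wallForm_add, wallForm_add, wallForm_mul, wallForm_mul,
        wallForm_mul]
      rfl
    refine ⟨?_, ?_, ?_⟩
    · rw [hside, I0, q0]
      have : 0 ≤ γ * wallSide r 0 s := mul_nonneg hγ h0.le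
      linarith
    · rw [hside, I1, h1, q1]
      have : 0 ≤ β * (2 * Real.cos (Real.pi / n) * x) := by positivity
      linarith
    · rw [wallSide_one_reflection_two h, hside, hside, I1, h1, q1, h2, q2]
      have : 0 ≤ 2 * Real.cos (Real.pi / n) * (α * x) := by positivity
      linarith
  · rintro ⟨a0, a1, a2⟩
    rw [wallSide_one_reflection_two h] at a2
    set k := 2 * Real.cos (Real.pi / n) * x with hk
    have hk0 : 0 < k := by positivity
    -- Barycentric coefficients: each of the three sides vanishes at two vertices, so a coefficient
    -- is the value at `z` of the side opposite the vertex, divided by its value at that vertex.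
    have hsep := wallForm_separating hr (A := coordA z) (B := coordB z) (C := coordC z)
      (A' := (wallSide r 1 z + 2 * Real.cos (Real.pi / n) * wallSide r 2 z) / k
          * coordA UpperHalfPlane.I + wallSide r 1 z / k * coordA q
          + wallSide r 0 z / wallSide r 0 s * coordA s)
      (B' := (wallSide r 1 z + 2 * Real.cos (Real.pi / n) * wallSide r 2 z) / k
          * coordB UpperHalfPlane.I + wallSide r 1 z / k * coordB q
          + wallSide r 0 z / wallSide r 0 s * coordB s)
      (C' := (wallSide r 1 z + 2 * Real.cos (Real.pi / n) * wallSide r 2 z) / k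
          * coordC UpperHalfPlane.I + wallSide r 1 z / k * coordC q
          + wallSide r 0 z / wallSide r 0 s * coordC s) (fun i => by
        rw [wallForm_add, wallForm_add, wallForm_mul, wallForm_mul, wallForm_mul]
        change wallSide r i z = _ * wallSide r i UpperHalfPlane.I + _ * wallSide r i q
          + _ * wallSide r i s
        fin_cases i
        · change wallSide r 0 z = _ * wallSide r 0 UpperHalfPlane.I + _ * wallSide r 0 q
            + _ * wallSide r 0 s
          rw [I0, q0]
          field_simp
          ring
        · change wallSide r 1 z = _ * wallSide r 1 UpperHalfPlane.I + _ * wallSide r 1 q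
            + _ * wallSide r 1 s
          rw [I1, h1, q1]
          field_simp
          ring
        · change wallSide r 2 z = _ * x + _ * wallSide r 2 q + _ * wallSide r 2 s
          rw [h2, q2, hk]
          field_simp
          ring)
    exact mem_triangle_of_coord (div_nonneg a2 hk0.le) (div_nonneg a1 hk0.le)
      (div_nonneg a0 h0.le) hsep.1 hsep.2.1 hsep.2.2

/-! ### Trigonometry -/

theorem UnitTangent.ne_zero {p : ℍ} (v : UnitTangent p) : v.1 ≠ 0 := by
  intro h
  have := v.2
  rw [h, norm_zero] at this
  exact p.im_pos.ne this

/-- Turning `v` multiplies `I / v` by `exp (2 θ I)`, hence its square root by `± exp (θ I)`. The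
sign comes from the branch of the root and does not affect the action on `ℍ`. -/
theorem frame_turnCW (p : ℍ) (v : UnitTangent p) (θ : ℝ) :
    frame p (v.turnCW (2 * θ)) = frame p v * rotMat θ ∨
      frame p (v.turnCW (2 * θ)) = -(frame p v * rotMat θ) := by
  have sq_root : ∀ w : ℂ, (w ^ (1 / 2 : ℂ)) ^ 2 = w := fun w => by
    rw [one_div]; exact Complex.cpow_nat_inv_pow _ two_ne_zero
  have hv := v.ne_zero
  obtain ⟨u, hu⟩ : ∃ u, u = (Complex.I / v.1) ^ (1 / 2 : ℂ) := ⟨_, rfl⟩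
  obtain ⟨u', hu'⟩ : ∃ u', u' = (Complex.I / (v.turnCW (2 * θ)).1) ^ (1 / 2 : ℂ) := ⟨_, rfl⟩
  have h2 : u ^ 2 = Complex.I / v.1 := by rw [hu, sq_root]
  have h2' : u' ^ 2 = Complex.I / (v.turnCW (2 * θ)).1 := by rw [hu', sq_root]
  have hsq : u' ^ 2 = (u * Complex.exp (θ * Complex.I)) ^ 2 := by
    rw [mul_pow, h2, h2', ← Complex.exp_nat_mul]
    change Complex.I / (Complex.exp (-(((2 * θ : ℝ) : ℂ) * Complex.I)) * v.1) = _
    rw [Complex.exp_neg]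
    push_cast
    rw [show 2 * ((θ : ℂ) * Complex.I) = 2 * θ * Complex.I by ring]
    field_simp
  have he : Complex.exp (θ * Complex.I) = ⟨Real.cos θ, Real.sin θ⟩ := by
    apply Complex.ext
    · simp [Complex.exp_ofReal_mul_I_re]
    · simp [Complex.exp_ofReal_mul_I_im]
  have hf : (frame p v : Matrix (Fin 2) (Fin 2) ℝ) =
      !![((p : ℂ) * u).im, ((p : ℂ) * u).re; u.im, u.re] := by rw [hu]; rfl
  have hf' : (frame p (v.turnCW (2 * θ)) : Matrix (Fin 2) (Fin 2) ℝ) =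
      !![((p : ℂ) * u').im, ((p : ℂ) * u').re; u'.im, u'.re] := by rw [hu']; rfl
  have hr : (rotMat θ : Matrix (Fin 2) (Fin 2) ℝ) =
      !![Real.cos θ, -Real.sin θ; Real.sin θ, Real.cos θ] := rfl
  rw [he] at hsq
  rcases sq_eq_sq_iff_eq_or_eq_neg.1 hsq with h | h
  · left
    apply Subtype.ext
    rw [Matrix.SpecialLinearGroup.coe_mul, hf, hf', hr, Matrix.mul_fin_two, h]
    ext i j
    fin_cases i <;> fin_cases j <;>
      simp only [Complex.mul_re, Complex.mul_im, Matrix.of_apply, Matrix.cons_val, Fin.zero_eta,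
        Fin.mk_one, Fin.isValue] <;> ring
  · right
    apply Subtype.ext
    rw [Matrix.SpecialLinearGroup.coe_neg, Matrix.SpecialLinearGroup.coe_mul, hf, hf', hr,
      Matrix.mul_fin_two, h]
    ext i j
    fin_cases i <;> fin_cases j <;>
      simp only [Complex.mul_re, Complex.mul_im, Matrix.of_apply, Matrix.cons_val, Fin.zero_eta,
        Fin.mk_one, Fin.isValue, Complex.neg_re, Complex.neg_im, Matrix.neg_apply] <;> ring

theorem neg_smul_eq (g : Matrix.SpecialLinearGroup (Fin 2) ℝ) (z : ℍ) : (-g) • z = g • z := by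
  have h : ∀ i j, (-g) i j = -(g i j) := fun i j => by
    rw [Matrix.SpecialLinearGroup.coe_neg, Matrix.neg_apply]
  apply ext_coord
  · rw [(coord_smul (-g) z).2.1, (coord_smul g z).2.1]
    simp only [h]
    ring
  · rw [(coord_smul (-g) z).2.2, (coord_smul g z).2.2]
    simp only [h]
    ring

theorem geodesic_turnCW (p : ℍ) (v : UnitTangent p) (θ t : ℝ) :
    geodesic p (v.turnCW (2 * θ)) t = frame p v • rotMat θ • diagMat t • UpperHalfPlane.I := by
  rw [geodesic, ← mul_smul (frame p v)]
  rcases frame_turnCW p v θ with h | h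
  · rw [h]
  · rw [h, neg_smul_eq]

theorem exists_turnCW_eq {p : ℍ} (v w : UnitTangent p) : ∃ θ : ℝ, w = v.turnCW (2 * θ) := by
  have hv := v.ne_zero
  refine ⟨-(w.1 / v.1).arg / 2, Subtype.ext ?_⟩
  have h1 := Complex.norm_mul_exp_arg_mul_I (w.1 / v.1)
  rw [norm_div, v.2, w.2, div_self p.im_pos.ne', Complex.ofReal_one, one_mul] at h1
  change w.1 = Complex.exp (-(((2 * (-(w.1 / v.1).arg / 2) : ℝ) : ℂ) * Complex.I)) * v.1
  rw [show (2 * (-(w.1 / v.1).arg / 2) : ℝ) = -(w.1 / v.1).arg by ring, Complex.ofReal_neg,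
    neg_mul, neg_neg, h1, div_mul_cancel₀ _ hv]

theorem cos_angle_turnCW {p : ℍ} (v : UnitTangent p) (θ : ℝ) :
    Real.cos (InnerProductGeometry.angle v.1 (v.turnCW θ).1) = Real.cos θ := by
  have hp := p.im_pos.ne'
  rw [InnerProductGeometry.cos_angle, v.2, (v.turnCW θ).2]
  have h1 : inner ℝ v.1 (v.turnCW θ).1 = Real.cos θ * (p.im * p.im) := by
    rw [Complex.inner]
    change (Complex.exp (-(θ * Complex.I)) * v.1 * (starRingEnd ℂ) v.1).re = _
    rw [mul_assoc, Complex.mul_conj,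
      Complex.normSq_eq_norm_sq, v.2, Complex.re_mul_ofReal,
      show -((θ : ℂ) * Complex.I) = ((-θ : ℝ) : ℂ) * Complex.I by push_cast; ring,
      Complex.exp_ofReal_mul_I_re, Real.cos_neg, sq]
  rw [h1]
  field_simp

theorem dist_geodesic (a : ℍ) (u : UnitTangent a) {t : ℝ} (ht : 0 ≤ t) :
    dist a (geodesic a u t) = t := by
  obtain ⟨h1, h2⟩ := geodesic_isometry a u
  have := h1.dist_eq 0 t
  rwa [h2, Real.dist_eq, zero_sub, abs_neg, abs_of_nonneg ht] at this

/-- The law of cosines, for two geodesics that leave the same point. -/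
theorem cosh_dist_geodesic (a : ℍ) (u : UnitTangent a) (θ t t' : ℝ) :
    Real.cosh (dist (geodesic a u t) (geodesic a (u.turnCW θ) t')) =
      Real.cosh t * Real.cosh t' - Real.sinh t * Real.sinh t' * Real.cos θ := by
  obtain ⟨θ, rfl⟩ : ∃ θ', θ = 2 * θ' := ⟨θ / 2, by ring⟩
  rw [geodesic_turnCW, geodesic, dist_smul, cosh_dist_coord]
  obtain ⟨h1, h2, h3⟩ := coord_polar θ t'
  obtain ⟨d1, d2, d3⟩ := coord_diagMat t UpperHalfPlane.I
  obtain ⟨i1, i2, i3⟩ := coord_I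
  rw [h1, h2, h3, d1, d2, d3, i1, i2, i3, Real.cosh_eq t, Real.sinh_eq t]
  ring

theorem exists_points {a b : ℍ} (hab : a ≠ b) : ∃ u : UnitTangent a, Points a u b := by
  obtain ⟨u⟩ : Nonempty (UnitTangent a) :=
    ⟨⟨(a.im : ℂ), by rw [Complex.norm_real, Real.norm_of_nonneg a.im_pos.le]⟩⟩
  set y := (frame a u)⁻¹ • b with hy
  have hdet := coord_det y
  have hA := coordA_pos y
  have hC := coordC_pos y
  -- By `coord_polar`, `w` has to be `sinh t` times the unit complex number of argument `2 θ`.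
  set w : ℂ := ⟨(coordA y - coordC y) / 2, coordB y⟩ with hw
  have hw0 : w ≠ 0 := by
    intro h0
    have h1 : (coordA y - coordC y) / 2 = 0 := congrArg Complex.re h0
    have h2 : coordB y = 0 := congrArg Complex.im h0
    obtain ⟨i1, i2, i3⟩ := coord_I
    have h3 : coordC y = 1 := by
      rw [h2, show coordA y = coordC y by linarith] at hdet
      nlinarith
    have h4 : y = UpperHalfPlane.I := ext_coord (by rw [h2, i2]) (by rw [h3, i3])
    apply hab
    rw [← frame_smul_I a u, ← h4, hy, smul_inv_smul]
  have hn := norm_pos_iff.2 hw0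
  set t := Real.arsinh ‖w‖ with ht
  have hs : Real.sinh t = ‖w‖ := Real.sinh_arsinh _
  have hc : Real.cosh t = (coordA y + coordC y) / 2 := by
    refine (sq_eq_sq₀ (Real.cosh_pos t).le (by positivity)).1 ?_
    rw [Real.cosh_sq, hs, Complex.sq_norm, Complex.normSq_apply, hw]
    linear_combination (-1) * hdet
  refine ⟨u.turnCW (2 * (w.arg / 2)), t, Real.arsinh_pos_iff.2 hn, ?_⟩
  obtain ⟨h1, h2, h3⟩ := coord_polar (w.arg / 2) t
  rw [geodesic_turnCW]
  rw [show 2 * (w.arg / 2) = w.arg by ring, hs] at h2 h3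
  rw [Complex.norm_mul_sin_arg] at h2
  rw [Complex.norm_mul_cos_arg, hc] at h3
  have h4 : rotMat (w.arg / 2) • diagMat t • UpperHalfPlane.I = y :=
    ext_coord h2 (by rw [h3, hw]; ring)
  rw [h4, hy, smul_inv_smul]

theorem HasAngle.cosh_dist {a b c : ℍ} {α : ℝ} (h : HasAngle a b c α) :
    Real.cosh (dist b c) = Real.cosh (dist a b) * Real.cosh (dist a c)
      - Real.sinh (dist a b) * Real.sinh (dist a c) * Real.cos α := by
  obtain ⟨u, w, ⟨t, ht, rfl⟩, ⟨t', ht', rfl⟩, rfl⟩ := h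
  obtain ⟨θ, rfl⟩ := exists_turnCW_eq u w
  rw [cos_angle_turnCW, cosh_dist_geodesic, dist_geodesic _ _ ht.le, dist_geodesic _ _ ht'.le]

theorem hasAngle_of_cosh_dist {a b c : ℍ} {α : ℝ} (hab : a ≠ b) (hac : a ≠ c) (h0 : 0 ≤ α)
    (hpi : α ≤ Real.pi) (h : Real.cosh (dist b c) = Real.cosh (dist a b) * Real.cosh (dist a c)
      - Real.sinh (dist a b) * Real.sinh (dist a c) * Real.cos α) : HasAngle a b c α := by
  obtain ⟨u, hu⟩ := exists_points hab
  obtain ⟨w, hw⟩ := exists_points hac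
  have h' : HasAngle a b c (InnerProductGeometry.angle u.1 w.1) := ⟨u, w, hu, hw, rfl⟩
  refine ⟨u, w, hu, hw, Real.injOn_cos
    ⟨InnerProductGeometry.angle_nonneg _ _, InnerProductGeometry.angle_le_pi _ _⟩ ⟨h0, hpi⟩ ?_⟩
  have h1 := h'.cosh_dist
  have s1 : 0 < Real.sinh (dist a b) := Real.sinh_pos_iff.2 (dist_pos.2 hab)
  have s2 : 0 < Real.sinh (dist a c) := Real.sinh_pos_iff.2 (dist_pos.2 hac)
  refine mul_left_cancel₀ (mul_pos s1 s2).ne' ?_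
  linarith

theorem HasAngle.ne {a b c : ℍ} {α : ℝ} (h : HasAngle a b c α) : a ≠ b ∧ a ≠ c := by
  obtain ⟨u, w, ⟨t, ht, rfl⟩, ⟨t', ht', rfl⟩, -⟩ := h
  refine ⟨dist_pos.1 ?_, dist_pos.1 ?_⟩
  · rwa [dist_geodesic _ _ ht.le]
  · rwa [dist_geodesic _ _ ht'.le]

/-- The sides of a triangle with angles `π / 4`, `π / 4`, `γ`. -/
theorem sides_of_angles {p q s : ℍ} {γ : ℝ} (hp : HasAngle p q s (Real.pi / 4))
    (hq : HasAngle q p s (Real.pi / 4)) (hs : HasAngle s p q γ) :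
    Real.cosh (dist p q) = 1 + 2 * Real.cos γ ∧ dist p s = dist q s := by
  have e1 := hp.cosh_dist
  have e2 := hq.cosh_dist
  have e3 := hs.cosh_dist
  rw [dist_comm q p] at e2
  rw [dist_comm s p, dist_comm s q] at e3
  rw [Real.cos_pi_div_four] at e1 e2
  have hk := Real.sq_sqrt (show (0 : ℝ) ≤ 2 by norm_num)
  have qa := Real.cosh_sq (dist q s)
  have qb := Real.cosh_sq (dist p s)
  have qc := Real.cosh_sq (dist p q)
  have hc1 : 1 < Real.cosh (dist p q) := Real.one_lt_cosh.2 (dist_pos.2 hp.ne.1).ne'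
  have ha0 := Real.cosh_pos (dist q s)
  have hb0 := Real.cosh_pos (dist p s)
  -- Squaring the laws of cosines at `p` and `q` removes the `sinh` factors; subtracting leaves `(y²
  -- - 1)` times the difference of the squared `cosh`.
  have hab : dist p s = dist q s := by
    have f1 : (Real.cosh (dist p q) * Real.cosh (dist p s) - Real.cosh (dist q s)) ^ 2 =
        (Real.cosh (dist p q) ^ 2 - 1) * (Real.cosh (dist p s) ^ 2 - 1) / 2 := by
      rw [e1, qc, qb]
      linear_combination (Real.sinh (dist p q) * Real.sinh (dist p s)) ^ 2 / 4 * hk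
    have f2 : (Real.cosh (dist p q) * Real.cosh (dist q s) - Real.cosh (dist p s)) ^ 2 =
        (Real.cosh (dist p q) ^ 2 - 1) * (Real.cosh (dist q s) ^ 2 - 1) / 2 := by
      rw [e2, qc, qa]
      linear_combination (Real.sinh (dist p q) * Real.sinh (dist q s)) ^ 2 / 4 * hk
    have f3 : (Real.cosh (dist p q) ^ 2 - 1) *
        (Real.cosh (dist p s) ^ 2 - Real.cosh (dist q s) ^ 2) = 0 := by
      linear_combination 2 * f1 - 2 * f2
    have f4 := (mul_eq_zero.1 f3).resolve_left (by nlinarith)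
    have f5 := (sq_eq_sq₀ hb0.le ha0.le).1 (sub_eq_zero.1 f4)
    rw [← Real.arcosh_cosh (dist_nonneg (x := p) (y := s)), f5, Real.arcosh_cosh dist_nonneg]
  refine ⟨?_, hab⟩
  rw [hab] at e1 e3
  set x := Real.cosh (dist q s)
  set y := Real.cosh (dist p q)
  have g1 : x ^ 2 * (y - 1) ^ 2 = (y ^ 2 - 1) * (x ^ 2 - 1) / 2 := by
    rw [qc, qa, show Real.sinh (dist p q) ^ 2 + 1 - 1 = Real.sinh (dist p q) ^ 2 by ring,
      show Real.sinh (dist q s) ^ 2 + 1 - 1 = Real.sinh (dist q s) ^ 2 by ring, ← qa]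
    have : x * (y - 1) = Real.sinh (dist p q) * Real.sinh (dist q s) * (Real.sqrt 2 / 2) := by
      linarith
    rw [← mul_pow, this]
    linear_combination (Real.sinh (dist p q) * Real.sinh (dist q s)) ^ 2 / 4 * hk
  have g2 : 2 * x ^ 2 * (y - 1) = (y + 1) * (x ^ 2 - 1) := by
    refine mul_left_cancel₀ (show y - 1 ≠ 0 by linarith) ?_
    linear_combination 2 * g1
  have g3 : y = x ^ 2 - (x ^ 2 - 1) * Real.cos γ := by
    rw [e3]
    linear_combination Real.cos γ * qa
  -- Eliminating `x` between the laws at `p` and at `s`; the root `y = 1` would mean `p = q`.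
  have g4 : (y - 1) * (y - 1 - 2 * Real.cos γ) = 0 := by
    linear_combination (y - 3) * g3 + (1 - Real.cos γ) * g2
  have := (mul_eq_zero.1 g4).resolve_left (by linarith)
  linarith

/-! ### Side length and existence of `T_n` -/

/-- The bound `5 ≤ n` gives a strictly positive cosine; at `n = 4` it is zero and the side length
degenerates to `0`. -/
theorem cos_two_pi_div_mem {n : ℕ} (hn : 5 ≤ n) :
    0 < Real.cos (2 * Real.pi / n) ∧ Real.cos (2 * Real.pi / n) < 1 ∧ 0 ≤ 2 * Real.pi / n ∧
      2 * Real.pi / n ≤ Real.pi := by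
  have hn' : (5 : ℝ) ≤ n := by exact_mod_cast hn
  have hpi := Real.pi_pos
  have h0 : 0 < 2 * Real.pi / n := by positivity
  have h1 : 2 * Real.pi / n < Real.pi / 2 := by
    rw [div_lt_iff₀ (by positivity)]
    nlinarith
  refine ⟨Real.cos_pos_of_mem_Ioo ⟨by linarith, h1⟩, ?_, h0.le, by linarith⟩
  rw [← Real.cos_zero]
  exact Real.cos_lt_cos_of_nonneg_of_le_pi le_rfl (by linarith) h0

theorem sideLength_spec {n : ℕ} (hn : 5 ≤ n) : 0 < sideLength n ∧
    Real.cosh (sideLength n) = 1 + 2 * Real.cos (2 * Real.pi / n) ∧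
    0 < Real.cos (Real.pi / n) ∧
    Real.cosh (sideLength n / 2) = Real.sqrt 2 * Real.cos (Real.pi / n) := by
  obtain ⟨h0, h1, h2, h3⟩ := cos_two_pi_div_mem hn
  have hpi := Real.pi_pos
  have hc : Real.cosh (sideLength n) = 1 + 2 * Real.cos (2 * Real.pi / n) :=
    Real.cosh_arcosh (by linarith)
  have hpos : 0 < Real.cos (Real.pi / n) := by
    rw [mul_div_assoc] at h2 h3
    exact Real.cos_pos_of_mem_Ioo ⟨by linarith, by
      refine lt_of_le_of_ne (by linarith) fun h => ?_
      rw [mul_div_assoc, h, mul_div_cancel₀ _ two_ne_zero, Real.cos_pi] at h0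
      linarith⟩
  refine ⟨Real.arcosh_pos (by linarith), hc, hpos, ?_⟩
  refine (sq_eq_sq₀ (Real.cosh_pos _).le (by positivity)).1 ?_
  have e1 := Real.cosh_two_mul (sideLength n / 2)
  have e2 := Real.cosh_sq (sideLength n / 2)
  have e3 := Real.cos_two_mul (Real.pi / n)
  have e4 := Real.sq_sqrt (show (0 : ℝ) ≤ 2 by norm_num)
  rw [mul_div_cancel₀ _ two_ne_zero, hc] at e1
  rw [← mul_div_assoc] at e3
  rw [mul_pow, e4]
  linarith

theorem exists_isPolygonTriangle {n : ℕ} (hn : 5 ≤ n) (p : ℍ) (v : UnitTangent p) :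
    ∃ q s : ℍ, IsPolygonTriangle n p v q s := by
  obtain ⟨g0, g1, g2, g3⟩ := cos_two_pi_div_mem hn
  obtain ⟨hr, hrc, -, -⟩ := sideLength_spec hn
  set r := sideLength n
  set g := Real.cos (2 * Real.pi / n)
  -- `x` is the `cosh` of the two equal sides, obtained by solving the law of cosines at `s`, `1 + 2
  -- g = x² - (x² - 1) g`.
  have hx1 : 1 < Real.sqrt ((1 + g) / (1 - g)) := by
    rw [Real.lt_sqrt zero_le_one, one_pow, lt_div_iff₀ (by linarith)]
    linarith
  have hx2 : Real.sqrt ((1 + g) / (1 - g)) ^ 2 * (1 - g) = 1 + g := by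
    rw [Real.sq_sqrt (div_nonneg (by linarith) (by linarith)), div_mul_cancel₀ _ (by linarith)]
  set x := Real.sqrt ((1 + g) / (1 - g))
  set b := Real.arcosh x
  have hb : 0 < b := Real.arcosh_pos hx1
  have hbc : Real.cosh b = x := Real.cosh_arcosh hx1.le
  obtain ⟨q, hq⟩ : ∃ q, q = geodesic p v r := ⟨_, rfl⟩
  obtain ⟨s, hs⟩ : ∃ s, s = geodesic p (v.turnCW (Real.pi / 4)) b := ⟨_, rfl⟩
  have hpq : dist p q = r := by rw [hq, dist_geodesic _ _ hr.le]
  have hps : dist p s = b := by rw [hs, dist_geodesic _ _ hb.le]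
  have hqs := cosh_dist_geodesic p v (Real.pi / 4) r b
  rw [← hq, ← hs] at hqs
  have hk := Real.sq_sqrt (show (0 : ℝ) ≤ 2 by norm_num)
  -- With this the law of cosines at `p` reads `cosh (dist q s) = (1 + 2 g) x - 2 g x = x`, so the
  -- triangle is isosceles.
  have key : Real.sinh r * Real.sinh b * Real.cos (Real.pi / 4) = x * (2 * g) := by
    have s1 := Real.sinh_pos_iff.2 hr
    have s2 := Real.sinh_pos_iff.2 hb
    rw [Real.cos_pi_div_four]
    refine (sq_eq_sq₀ (by positivity) (by positivity)).1 ?_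
    have q1 := Real.cosh_sq r
    have q2 := Real.cosh_sq b
    rw [hrc] at q1
    rw [hbc] at q2
    rw [mul_pow, mul_pow, div_pow, hk, show Real.sinh r ^ 2 = (1 + 2 * g) ^ 2 - 1 by linarith,
      show Real.sinh b ^ 2 = x ^ 2 - 1 by linarith]
    linear_combination 2 * g * hx2
  rw [hrc, hbc, key] at hqs
  have hqs' : dist q s = b := by
    rw [← Real.arcosh_cosh (dist_nonneg (x := q) (y := s)), hqs]
    congr 1
    ring
  have hpi := Real.pi_pos
  have npq : p ≠ q := dist_pos.1 (by rw [hpq]; exact hr)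
  have nps : p ≠ s := dist_pos.1 (by rw [hps]; exact hb)
  have nqs : q ≠ s := dist_pos.1 (by rw [hqs']; exact hb)
  refine ⟨q, s, ⟨r, hr, hq.symm⟩, ⟨b, hb, hs.symm⟩, ?_, ?_, ?_⟩
  · refine hasAngle_of_cosh_dist npq nps (by positivity) (by linarith) ?_
    rw [hpq, hps, hqs', key, hrc, hbc]
    ring
  · refine hasAngle_of_cosh_dist npq.symm nqs (by positivity) (by linarith) ?_
    rw [dist_comm q p, hpq, hps, hqs', key, hrc, hbc]
    ring
  · refine hasAngle_of_cosh_dist nps.symm nqs.symm g2 g3 ?_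
    rw [dist_comm s p, dist_comm s q, hpq, hps, hqs', hrc, hbc]
    have q2 := Real.cosh_sq b
    rw [hbc] at q2
    linear_combination (-1) * hx2 - g * q2

/-! ### Transport to an arbitrary base point -/

theorem triangle_image (φ : ℍ ≃ᵢ ℍ) (a b c : ℍ) :
    triangle (φ a) (φ b) (φ c) = φ '' triangle a b c := by
  ext z
  constructor
  · rintro ⟨x, hx, hz⟩
    refine ⟨φ.symm z, ⟨φ.symm x, ?_, ?_⟩, φ.apply_symm_apply z⟩
    · change dist b (φ.symm x) + dist (φ.symm x) c = dist b c
      rw [← φ.isometry.dist_eq, ← φ.isometry.dist_eq _ c, ← φ.isometry.dist_eq b c,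
        φ.apply_symm_apply]
      exact hx
    · change dist a (φ.symm z) + dist (φ.symm z) (φ.symm x) = dist a (φ.symm x)
      rw [φ.symm.isometry.dist_eq, ← φ.isometry.dist_eq, ← φ.isometry.dist_eq a (φ.symm x),
        φ.apply_symm_apply, φ.apply_symm_apply]
      exact hz
  · rintro ⟨y, ⟨x, hx, hy⟩, rfl⟩
    refine ⟨φ x, ?_, ?_⟩
    · change dist (φ b) (φ x) + dist (φ x) (φ c) = dist (φ b) (φ c)
      rw [φ.isometry.dist_eq, φ.isometry.dist_eq, φ.isometry.dist_eq]
      exact hx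
    · change dist (φ a) (φ y) + dist (φ y) (φ x) = dist (φ a) (φ x)
      rw [φ.isometry.dist_eq, φ.isometry.dist_eq, φ.isometry.dist_eq]
      exact hy

/-- In the frame at `p`, the angles put `q` at `exp r * i`, the direction of `s` puts it on wall
`1`, and `dist p s = dist q s` puts it on the perpendicular bisector, wall `2`. These conditions
characterize the third vertex of the chamber. -/
theorem isPolygonTriangle_eq {n : ℕ} (hn : 5 ≤ n) {p : ℍ} {v : UnitTangent p} {q s : ℍ}
    (h : IsPolygonTriangle n p v q s) :
    triangle p q s = moebius (frame p v) '' baseTriangle (sideLength n) := by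
  obtain ⟨hr, hrc, hcos, hrn⟩ := sideLength_spec hn
  set r := sideLength n
  have hsys := reflectionSystem (by omega : 2 ≤ n) hr hrn
  obtain ⟨hc, hab⟩ := sides_of_angles h.angle_p h.angle_q h.angle_s
  have hpq : dist p q = r := by
    rw [← Real.arcosh_cosh (dist_nonneg (x := p) (y := q)), hc, ← hrc, Real.arcosh_cosh hr.le]
  obtain ⟨t, ht, rfl⟩ := h.dir_q
  obtain ⟨b, hb, rfl⟩ := h.dir_s
  rw [dist_geodesic _ _ ht.le] at hpq
  subst hpq
  rw [show Real.pi / 4 = 2 * (Real.pi / 8) by ring, geodesic_turnCW] at hab ⊢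
  obtain ⟨s, hs⟩ : ∃ s, s = rotMat (Real.pi / 8) • diagMat b • UpperHalfPlane.I := ⟨_, rfl⟩
  rw [← hs] at hab ⊢
  have hp : moebius (frame p v) UpperHalfPlane.I = p := frame_smul_I p v
  obtain ⟨h1, h2, h3⟩ := coord_polar (Real.pi / 8) b
  obtain ⟨i1, i2, i3⟩ := coord_I
  obtain ⟨d1, d2, d3⟩ := coord_diagMat r UpperHalfPlane.I
  rw [← hs, show 2 * (Real.pi / 8) = Real.pi / 4 by ring] at h1 h2 h3
  rw [Real.cos_pi_div_four] at h1 h3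
  rw [Real.sin_pi_div_four] at h2
  have key := triangle_eq_baseTriangle hr hcos hrn hsys (s := s) ?_ ?_ ?_
  · rw [← key, ← triangle_image, hp]
    rfl
  · change 0 < coordB s
    rw [h2]
    have := Real.sinh_pos_iff.2 hb
    positivity
  · change (coordA s - 2 * coordB s - coordC s) / (2 * Real.sqrt 2) = 0
    rw [h1, h2, h3]
    ring
  · change (Real.exp (r / 2) * coordC s - Real.exp (-(r / 2)) * coordA s) / 2 = 0
    nth_rewrite 1 [← frame_smul_I p v] at hab
    rw [geodesic, dist_smul, dist_smul] at hab
    have e := congrArg Real.cosh hab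
    obtain ⟨e1, e2, e3⟩ := exp_half_mul r
    rw [cosh_dist_coord, cosh_dist_coord, d1, d2, d3, i1, i2, i3, e2, e3] at e
    have hlt : Real.exp (-(r / 2)) < Real.exp (r / 2) := Real.exp_lt_exp.2 (by linarith)
    have : (Real.exp (r / 2) - Real.exp (-(r / 2))) *
        (Real.exp (r / 2) * coordC s - Real.exp (-(r / 2)) * coordA s) = 0 := by
      linear_combination (-2) * e - (coordC s + coordA s) * e1
    rw [(mul_eq_zero.1 this).resolve_left (by linarith), zero_div]

theorem map_turtleGroup (p : ℍ) (v : UnitTangent p) (r : ℝ) :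
    (turtleGroup p v r).map IsomPlus.subtype =
      (baseGroup r).map (MulAut.conj (moebius (frame p v))).toMonoidHom := by
  rw [turtleGroup, baseGroup, MonoidHom.map_closure, MonoidHom.map_closure, Set.image_pair,
    Set.image_pair]
  simp [quarterTurn, translation]

theorem exists_baseGroup_of_mem {p : ℍ} {v : UnitTangent p} {r : ℝ} {g : IsomPlus}
    (hg : g ∈ turtleGroup p v r) : ∃ g₀ ∈ baseGroup r,
      g.1 = moebius (frame p v) * g₀ * (moebius (frame p v))⁻¹ := by
  have h : g.1 ∈ (turtleGroup p v r).map IsomPlus.subtype := ⟨g, hg, rfl⟩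
  rw [map_turtleGroup] at h
  obtain ⟨g₀, hg₀, h⟩ := h
  exact ⟨g₀, hg₀, h.symm⟩

theorem exists_mem_of_baseGroup (p : ℍ) (v : UnitTangent p) {r : ℝ} {g₀ : ℍ ≃ᵢ ℍ}
    (hg₀ : g₀ ∈ baseGroup r) : ∃ g ∈ turtleGroup p v r,
      g.1 = moebius (frame p v) * g₀ * (moebius (frame p v))⁻¹ := by
  have h : moebius (frame p v) * g₀ * (moebius (frame p v))⁻¹ ∈
      (baseGroup r).map (MulAut.conj (moebius (frame p v))).toMonoidHom := ⟨g₀, hg₀, rfl⟩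
  rw [← map_turtleGroup] at h
  exact h

theorem conj_apply (φ g : ℍ ≃ᵢ ℍ) (z : ℍ) : (φ * g * φ⁻¹) (φ z) = φ (g z) := by
  rw [IsometryEquiv.mul_apply, IsometryEquiv.mul_apply, IsometryEquiv.inv_apply_self]

theorem isFundDomain_turtleGroup {n : ℕ} (hn : 5 ≤ n) (p : ℍ) (v : UnitTangent p) :
    IsFundDomain (turtleGroup p v (sideLength n))
      (moebius (frame p v) '' baseTriangle (sideLength n)) := by
  obtain ⟨hr, -, -, hrn⟩ := sideLength_spec hn
  have hsys := reflectionSystem (by omega : 2 ≤ n) hr hrn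
  set φ := moebius (frame p v)
  constructor
  · refine Set.eq_univ_of_forall fun z => ?_
    obtain ⟨g₀, hg₀, y, hy, hgy⟩ := baseTriangle_cover (by omega : 2 ≤ n) hr hsys (φ⁻¹ z)
    obtain ⟨g, hg, hgφ⟩ := exists_mem_of_baseGroup p v hg₀
    refine Set.mem_iUnion₂.2 ⟨g, hg, φ y, ⟨y, hy, rfl⟩, ?_⟩
    change g.1 (φ y) = z
    rw [hgφ, conj_apply, hgy, IsometryEquiv.apply_inv_self]
  · intro g hg h hh hne
    rw [Set.disjoint_left]
    rintro _ ⟨_, ⟨z, hz, rfl⟩, rfl⟩ hint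
    obtain ⟨g₀, hg₀, hgφ⟩ := exists_baseGroup_of_mem hg
    obtain ⟨h₀, hh₀, hhφ⟩ := exists_baseGroup_of_mem hh
    apply hne
    have himage : translate h (φ '' baseTriangle (sideLength n)) =
        (h.1 * φ) '' baseTriangle (sideLength n) := by
      rw [translate, Set.image_image]
      rfl
    rw [himage, ← IsometryEquiv.coe_toHomeomorph, ← Homeomorph.image_interior] at hint
    obtain ⟨y, hy, hyz⟩ := hint
    change (h.1 * φ) y = g.1 (φ z) at hyz
    rw [IsometryEquiv.mul_apply, hgφ, hhφ, conj_apply, conj_apply] at hyz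
    have hyz := φ.injective hyz
    have hy' : (h₀⁻¹ * g₀) z = y := by
      rw [IsometryEquiv.mul_apply, ← hyz, IsometryEquiv.inv_apply_self]
    have := baseTriangle_disjoint (by omega : 2 ≤ n) hr hsys (mul_mem (inv_mem hh₀) hg₀) hz
      (hy'.symm ▸ hy)
    apply Subtype.ext
    rw [hgφ, hhφ, inv_mul_eq_one.1 this]

/-- Evaluation at the image of a chamber point is continuous for pointwise convergence, and an
`ε`-ball about any value contains the value of only one group element. -/
theorem discreteTopology_turtleGroup {n : ℕ} (hn : 5 ≤ n) (p : ℍ) (v : UnitTangent p) :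
    DiscreteTopology (turtleGroup p v (sideLength n)) := by
  obtain ⟨hr, -, -, hrn⟩ := sideLength_spec hn
  have hsys := reflectionSystem (by omega : 2 ≤ n) hr hrn
  obtain ⟨x, hx⟩ := exists_chamber_point hr
  obtain ⟨ε, hε, hsep⟩ := hsys.exists_eq_of_dist_lt (continuous_wallSide _) hx
  set φ := moebius (frame p v)
  rw [discreteTopology_iff_isOpen_singleton]
  intro g
  have hind : Continuous fun (g : IsomPlus) (z : ℍ) => g.1 z := continuous_induced_dom
  have hcont : Continuous fun h : turtleGroup p v (sideLength n) => h.1.1 (φ x) :=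
    (continuous_apply (φ x)).comp (hind.comp continuous_subtype_val)
  have hball : {g} = (fun h : turtleGroup p v (sideLength n) => h.1.1 (φ x)) ⁻¹'
      Metric.ball (g.1.1 (φ x)) ε := by
    ext h
    constructor
    · rintro rfl
      exact Metric.mem_ball_self hε
    · intro hh
      obtain ⟨g₀, hg₀, hgφ⟩ := exists_baseGroup_of_mem g.2
      obtain ⟨h₀, hh₀, hhφ⟩ := exists_baseGroup_of_mem h.2
      change dist (h.1.1 (φ x)) (g.1.1 (φ x)) < ε at hh
      rw [hgφ, hhφ, conj_apply, conj_apply, φ.isometry.dist_eq] at hh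
      have := hsep h₀ (baseGroup_le _ hh₀) g₀ (baseGroup_le _ hg₀) hh
      apply Subtype.ext
      apply Subtype.ext
      rw [hgφ, hhφ, this]
  rw [hball]
  exact Metric.isOpen_ball.preimage hcont

end HypTurtle

theorem mainTheorem4 (n : ℕ) (hn : 5 ≤ n) (p : UpperHalfPlane) (v : HypTurtle.UnitTangent p) :
    DiscreteTopology (HypTurtle.turtleGroup p v (HypTurtle.sideLength n)) ∧
    (∃ q s : UpperHalfPlane, HypTurtle.IsPolygonTriangle n p v q s) ∧
    ∀ q s : UpperHalfPlane, HypTurtle.IsPolygonTriangle n p v q s →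
      HypTurtle.IsFundDomain (HypTurtle.turtleGroup p v (HypTurtle.sideLength n))
        (HypTurtle.triangle p q s) := by
  refine ⟨HypTurtle.discreteTopology_turtleGroup hn p v,
    HypTurtle.exists_isPolygonTriangle hn p v, fun q s h => ?_⟩
  rw [HypTurtle.isPolygonTriangle_eq hn h]
  exact HypTurtle.isFundDomain_turtleGroup hn p v
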